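/- \textbf{Theorem (Super-Exponential Case).} For $\mathbf{x},\mathbf{y}\in\mathbb{R}^n$ with means $\bar x=\frac1n\sum_i x_i$, $\bar y=\frac1n\sum_i y_i$, let $$\rho_{\mathbf{x},\mathbf{y}}=\frac{\sum_{i=1}^n (x_i-\bar x)(y_i-\bar y)}{\sqrt{\sum_{i=1}^n (x_i-\bar x)^2\cdot\sum_{i=1}^n (y_i-\bar y)^2}}$$ denote the Pearson correlation coefficient. For each $n\ge 1$ let $p=p_n$ be a natural number and let $\mathbf{X}_1,\dots,\mathbf{X}_p$ be independent random vectors in $\mathbb{R}^n$ (defined on a probability space that may depend on $n$) with a common spherical distribution (which may depend on $n$), that is, $\mathbf{O}\mathbf{X}_1$ and $\mathbf{X}_1$ have the same distribution for every orthogonal $n\times n$ matrix $\mathbf{O}$, and with $P(\mathbf{X}_1=\mathbf{0})=0$. Let $\rho_{ij}=\rho_{\mathbf{X}_i,\mathbf{X}_j}$, let $L_n=\max_{1\le i<j\le p}|\rho_{ij}|$ be the coherence of the $n\times p$ matrix $(\mathbf{X}_1,\dots,\mathbf{X}_p)$, and let $T_n=\log(1-L_n^2)$. Suppose $(\log p_n)/n\to\infty$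 as $n\to\infty$. Then: (i) $L_n\to 1$ in probability as $n\to\infty$, and $\frac{n}{\log p_n}\,T_n\to -4$ in probability as $n\to\infty$. (ii) As $n\to\infty$, $$nT_n+\frac{4n}{n-2}\log p_n-\log n$$ converges weakly to the distribution function $F(y)=1-e^{-Ke^{y/2}}$, $y\in\mathbb{R}$, with $K=1/\sqrt{2\pi}$. -/

import Mathlib

open Filter Topology MeasureTheory ProbabilityTheory

noncomputable section

/-- The mean `(x₁ + ⋯ + xₙ) / n` of the coordinates of `x ∈ ℝⁿ`. -/
def coordMean {n : ℕ} (x : Fin n → ℝ) : ℝ :=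
  (∑ k, x k) / n

/-- The Pearson correlation coefficient of `x, y ∈ ℝⁿ`. -/
def pearson {n : ℕ} (x y : Fin n → ℝ) : ℝ :=
  (∑ k, (x k - coordMean x) * (y k - coordMean y)) /
    √((∑ k, (x k - coordMean x) ^ 2) * ∑ k, (y k - coordMean y) ^ 2)

/-- The coherence `max_{i < j} |ρ_{ij}|` of the matrix with columns `x₁, …, x_p ∈ ℝⁿ`.
The index set is finite, so for `2 ≤ p` the supremum is a maximum. -/
def coherence {n p : ℕ} (x : Fin p → Fin n → ℝ) : ℝ :=
  ⨆ q : {q : Fin p × Fin p // q.1 < q.2}, |pearson (x q.1.1) (x q.1.2)|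

/-- The random vector `Y` in `ℝⁿ` has a spherical distribution: `O Y` and `Y` have the same law
for every orthogonal matrix `O`. -/
def IsSpherical {Ω : Type*} [MeasurableSpace Ω] (P : Measure Ω) {n : ℕ}
    (Y : Ω → Fin n → ℝ) : Prop :=
  ∀ O ∈ Matrix.orthogonalGroup (Fin n) ℝ,
    IdentDistrib (fun ω => Matrix.mulVec O (Y ω)) Y P P

/-- The columns `X₁, …, X_p` are independent random vectors in `ℝⁿ` with a common spherical
distribution that gives no mass to the origin. -/
structure IIDSphericalColumns {Ω : Type*} [MeasurableSpace Ω] (P : Measure Ω) {n p : ℕ}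
    (X : Fin p → Ω → Fin n → ℝ) : Prop where
  measurable : ∀ j, Measurable (X j)
  indep : iIndepFun X P
  identDistrib : ∀ i j, IdentDistrib (X i) (X j) P P
  spherical : ∀ j, IsSpherical P (X j)
  ne_zero : ∀ j, P {ω | X j ω = 0} = 0

/-- Convergence in probability to the constant `c`; the `n`-th variable may live on its own
probability space. -/
def TendstoInProbability {Ω : ℕ → Type*} [∀ n, MeasurableSpace (Ω n)]
    (P : ∀ n, Measure (Ω n)) (Y : ∀ n, Ω n → ℝ) (c : ℝ) : Prop :=
  ∀ ε : ℝ, 0 < ε → Tendsto (fun n => P n {ω | ε ≤ |Y n ω - c|}) atTop (𝓝 0)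

/-- `F` is the distribution function of a probability measure on `ℝ`, and the laws of the `Y n`
converge weakly to that measure. -/
def ConvergesWeaklyToCDF {Ω : ℕ → Type*} [∀ n, MeasurableSpace (Ω n)]
    (P : ∀ n, Measure (Ω n)) [∀ n, IsProbabilityMeasure (P n)] (Y : ∀ n, Ω n → ℝ)
    (F : ℝ → ℝ) : Prop :=
  ∃ (ν : Measure ℝ) (_ : IsProbabilityMeasure ν),
    (∀ y, cdf ν y = F y) ∧ TendstoInDistribution Y atTop (id : ℝ → ℝ) P ν

end

/-! A correlation is the cosine of the angle between two centered vectors. Centering projects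
orthogonally onto a hyperplane of dimension n - 1 and keeps the law invariant under reflections of
that hyperplane. So, whatever the law, a given pair satisfies |ρ| ≥ t with the same probability q =
`capProb (n - 2) t`, and this remains so conditionally on one of the two vectors. Hence the events
|ρ_ij| ≥ t and |ρ_ik| ≥ t that share a vector are independent: condition on the shared one.

The number of pairs with |ρ| ≥ t is therefore a sum of locally dependent, pairwise independent
indicators. The Chen–Stein bound `abs_prob_none_sub_exp_le` gives P(L < t) = exp(-q p(p-1)/2) up to
an error of order p³q². It remains to choose t so that p²q/2 converges; then p³q² is of order 1/p
and vanishes.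

The value of q is a volume ratio: the part of the unit ball inside a double cone, sliced
orthogonally to the axis. When (log p)/n → ∞ the threshold t tends to 1, the conical part dominates,
and q is asymptotic to an explicit multiple of (1 - t²)^((n-2)/2) (`tendsto_sq_mul_capProb`). The
factor n/(n-2) in the normalisation turns this power into exactly p⁻² times subexponential factors.

Since log(1 - L²) decreases in L, the limit of P(L ≥ t) is the limiting distribution function, which
gives (ii). Tightness and division by log p give the second half of (i), and that in turn forces L →
1 because n/log p → 0. -/

/-! ### Poisson approximation by the Chen–Stein method -/

/-- The solution `k ↦ ∫₀¹ sᵏ e^{-λs} ds` of the Stein equation of the Poisson distribution with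
parameter `λ` for the indicator of `{0}`. -/
noncomputable def steinSol (lam : ℝ) (k : ℕ) : ℝ :=
  ∫ s in (0 : ℝ)..1, s ^ k * Real.exp (-(lam * s))

lemma steinSol_nonneg (lam : ℝ) (k : ℕ) : 0 ≤ steinSol lam k := by
  apply intervalIntegral.integral_nonneg zero_le_one
  intro s hs
  have := hs.1
  positivity

lemma steinSol_le_one {lam : ℝ} (hl : 0 ≤ lam) (k : ℕ) : steinSol lam k ≤ 1 := by
  have h : steinSol lam k ≤ ∫ _ in (0 : ℝ)..1, (1 : ℝ) := by
    apply intervalIntegral.integral_mono_on zero_le_one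
    · exact Continuous.intervalIntegrable (by fun_prop) _ _
    · exact Continuous.intervalIntegrable (by fun_prop) _ _
    · intro s hs
      have h1 : s ^ k ≤ 1 := pow_le_one₀ hs.1 hs.2
      have h2 : Real.exp (-(lam * s)) ≤ 1 := by
        rw [Real.exp_le_one_iff]
        have := mul_nonneg hl hs.1
        linarith
      exact mul_le_one₀ h1 (Real.exp_nonneg _) h2
  simpa using h

lemma steinSol_zero (lam : ℝ) : lam * steinSol lam 0 = 1 - Real.exp (-lam) := by
  have hd : ∀ s : ℝ, HasDerivAt (fun s => -Real.exp (-(lam * s)))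
      (lam * (s ^ 0 * Real.exp (-(lam * s)))) s := by
    intro s
    have h := (((hasDerivAt_id s).const_mul lam).neg.exp).neg
    convert! h using 1
    simp; ring
  have := intervalIntegral.integral_eq_sub_of_hasDerivAt (a := 0) (b := 1) (fun s _ => hd s)
    (Continuous.intervalIntegrable (by fun_prop) _ _)
  rw [intervalIntegral.integral_const_mul] at this
  rw [steinSol, this]
  simp; ring

lemma steinSol_succ (lam : ℝ) (k : ℕ) :
    lam * steinSol lam (k + 1) - (k + 1 : ℕ) * steinSol lam k = -Real.exp (-lam) := by
  have hd : ∀ s : ℝ, HasDerivAt (fun s => -(s ^ (k + 1) * Real.exp (-(lam * s))))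
      (lam * (s ^ (k + 1) * Real.exp (-(lam * s))) -
        (k + 1 : ℕ) * (s ^ k * Real.exp (-(lam * s)))) s := by
    intro s
    have h := ((hasDerivAt_pow (k + 1) s).mul (((hasDerivAt_id s).const_mul lam).neg.exp)).neg
    convert! h using 1
    simp; ring
  have := intervalIntegral.integral_eq_sub_of_hasDerivAt (a := 0) (b := 1) (fun s _ => hd s)
    (Continuous.intervalIntegrable (by fun_prop) _ _)
  rw [intervalIntegral.integral_sub (Continuous.intervalIntegrable (by fun_prop) _ _)
    (Continuous.intervalIntegrable (by fun_prop) _ _), intervalIntegral.integral_const_mul,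
    intervalIntegral.integral_const_mul] at this
  rw [steinSol, steinSol, this]
  simp

/-- The index is shifted by one against the usual Stein equation, so the solution starts at 0. For
`k = 0` the truncated `k - 1` is harmless because its factor vanishes. -/
lemma steinSol_equation (lam : ℝ) (k : ℕ) :
    (if k = 0 then 1 else 0) - Real.exp (-lam) =
      lam * steinSol lam k - k * steinSol lam (k - 1) := by
  cases k with
  | zero => simp [steinSol_zero]
  | succ k => simpa using (steinSol_succ lam k).symm

/-- **Poisson approximation** of the probability that none of finitely many equally likely locally
dependent events occurs (Chen–Stein method). -/
theorem abs_prob_none_sub_exp_le {Ω ι : Type*} [MeasurableSpace Ω] [Fintype ι] [DecidableEq ι]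
    (P : Measure Ω) [IsProbabilityMeasure P] (A : ι → Set Ω) (hA : ∀ a, MeasurableSet (A a))
    (B : ι → Finset ι) (hB : ∀ a, a ∈ B a) {M q : ℝ} (hM : ∀ a, ((B a).card : ℝ) ≤ M)
    (hq : ∀ a, P.real (A a) = q)
    (hpair : ∀ a, ∀ b ∈ B a, b ≠ a → P.real (A a ∩ A b) = q ^ 2)
    (hind : ∀ a, IndepFun ((A a).indicator (1 : Ω → ℕ))
      (fun ω => ∑ b ∈ (B a)ᶜ, (A b).indicator (1 : Ω → ℕ) ω) P) :
    |P.real {ω | ∀ a, ω ∉ A a} - Real.exp (-(Fintype.card ι * q))| ≤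
      Fintype.card ι * (2 * M * q ^ 2) := by
  rcases isEmpty_or_nonempty ι with hι | ⟨⟨a₀⟩⟩
  · simp
  have hq0 : 0 ≤ q := by rw [← hq a₀]; positivity
  set lam : ℝ := Fintype.card ι * q with hlam
  have hl0 : 0 ≤ lam := by positivity
  set I : ι → Ω → ℕ := fun a => (A a).indicator (1 : Ω → ℕ) with hI
  have hIm : ∀ a, Measurable (I a) := fun a => measurable_one.indicator (hA a)
  set N : Ω → ℕ := fun ω => ∑ a, I a ω with hN
  have hNm : Measurable N := Finset.measurable_sum _ fun a _ => hIm a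
  set W : ι → Ω → ℕ := fun a ω => ∑ b ∈ (B a)ᶜ, I b ω with hW
  have hWm : ∀ a, Measurable (W a) := fun a => Finset.measurable_sum _ fun b _ => hIm b
  set g := steinSol lam with hg
  have hg0 : ∀ k, 0 ≤ g k := steinSol_nonneg lam
  have hg1 : ∀ k, g k ≤ 1 := steinSol_le_one hl0
  have hI01 : ∀ a ω, I a ω = 0 ∨ I a ω = 1 := by
    intro a ω
    by_cases h : ω ∈ A a <;> simp [hI, h]
  have hint : ∀ (f : Ω → ℕ), Measurable f → ∀ G : ℕ → ℝ, (∀ k, 0 ≤ G k) → (∀ k, G k ≤ 1) →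
      Integrable (fun ω => G (f ω)) P := by
    intro f hf G h0 h1
    refine Integrable.of_bound ((measurable_from_top (f := G)).comp hf).aestronglyMeasurable 1 ?_
    filter_upwards with ω
    rw [Real.norm_of_nonneg (h0 _)]
    exact h1 _
  have hIR : ∀ a, (fun ω => (I a ω : ℝ)) = (A a).indicator 1 := by
    intro a; ext ω
    by_cases h : ω ∈ A a <;> simp [hI, h]
  have hIint : ∀ a, Integrable (fun ω => (I a ω : ℝ)) P := by
    intro a
    rw [hIR]
    exact (integrable_const (1 : ℝ)).indicator (hA a)
  have hIE : ∀ a, ∫ ω, (I a ω : ℝ) ∂P = q := by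
    intro a
    rw [hIR, integral_indicator_one (hA a), hq]
  have hIIR : ∀ a b, (fun ω => (I a ω : ℝ) * I b ω) = (A a ∩ A b).indicator 1 := by
    intro a b; ext ω
    by_cases h : ω ∈ A a <;> by_cases h' : ω ∈ A b <;> simp [hI, h, h']
  have hIIint : ∀ a b, Integrable (fun ω => (I a ω : ℝ) * I b ω) P := by
    intro a b
    rw [hIIR]
    exact (integrable_const (1 : ℝ)).indicator ((hA a).inter (hA b))
  have hIg : ∀ a (f : Ω → ℕ), Measurable f → Integrable (fun ω => (I a ω : ℝ) * g (f ω)) P := by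
    intro a f hf
    refine (hint f hf g hg0 hg1).bdd_mul (c := 1)
      ((measurable_from_top (f := fun k : ℕ => (k : ℝ))).comp (hIm a)).aestronglyMeasurable ?_
    filter_upwards with ω
    rcases hI01 a ω with h | h <;> simp [h]
  have hdiff : ∀ k l, |g k - g l| ≤ 1 := by
    intro k l
    rw [abs_le]
    constructor <;> linarith [hg0 k, hg0 l, hg1 k, hg1 l]
  have hNsplit : ∀ a ω, N ω = W a ω + ∑ b ∈ B a, I b ω := by
    intro a ω
    simp only [hN, hW]
    rw [add_comm, Finset.sum_add_sum_compl]
  -- Both terms are compared with the value of `g` at `W a`, the count outside the neighbourhood of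
  -- `a`, where independence makes them equal. As `g` takes values in [0, 1], each replacement costs
  -- at most the number of events that occur among those left out: `M * q` in mean, times the factor
  -- `q`, for the first term, and pair probabilities `q ^ 2` for the second.
  have hstep : ∀ a, |q * ∫ ω, g (N ω) ∂P - ∫ ω, (I a ω : ℝ) * g (N ω - 1) ∂P| ≤
      2 * M * q ^ 2 := by
    intro a
    have e1 : ∫ ω, (I a ω : ℝ) * g (W a ω) ∂P = q * ∫ ω, g (W a ω) ∂P := by
      have h := (hind a).comp (measurable_from_top (f := fun k : ℕ => (k : ℝ)))
        (measurable_from_top (f := g))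
      rw [← hIE a]
      exact h.integral_fun_mul_eq_mul_integral
        (hIint a).aestronglyMeasurable (hint _ (hWm a) g hg0 hg1).aestronglyMeasurable
    have b1 : |∫ ω, (g (N ω) - g (W a ω)) ∂P| ≤ M * q := by
      calc |∫ ω, (g (N ω) - g (W a ω)) ∂P|
          ≤ ∫ ω, ∑ b ∈ B a, (I b ω : ℝ) ∂P := by
            rw [← Real.norm_eq_abs]
            refine norm_integral_le_of_norm_le (integrable_finsetSum _ fun b _ => hIint b) ?_
            filter_upwards with ω
            rw [Real.norm_eq_abs, ← Nat.cast_sum]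
            rcases Nat.eq_zero_or_pos (∑ b ∈ B a, I b ω) with h | h
            · simp [hNsplit a ω, h]
            · exact (hdiff _ _).trans (by exact_mod_cast h)
        _ = (B a).card * q := by
            rw [integral_finsetSum _ fun b _ => hIint b]
            simp [hIE]
        _ ≤ M * q := by gcongr; exact hM a
    have b2 : |∫ ω, ((I a ω : ℝ) * g (N ω - 1) - I a ω * g (W a ω)) ∂P| ≤ M * q ^ 2 := by
      calc |∫ ω, ((I a ω : ℝ) * g (N ω - 1) - I a ω * g (W a ω)) ∂P|
          ≤ ∫ ω, ∑ b ∈ (B a).erase a, (I a ω : ℝ) * I b ω ∂P := by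
            rw [← Real.norm_eq_abs]
            refine norm_integral_le_of_norm_le (integrable_finsetSum _ fun b _ => hIIint a b) ?_
            filter_upwards with ω
            rw [Real.norm_eq_abs, ← Finset.mul_sum, ← Nat.cast_sum, ← mul_sub, abs_mul,
              Nat.abs_cast]
            -- When `I a ω = 1`, the `- 1` in `N ω - 1` removes exactly the contribution of `a`, so
            -- only the other neighbours matter. When `I a ω = 0` the whole term vanishes.
            have hs : N ω = W a ω + (I a ω + ∑ b ∈ (B a).erase a, I b ω) := by
              rw [hNsplit a ω, Finset.add_sum_erase _ (fun b => I b ω) (hB a)]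
            rcases hI01 a ω with h1 | h1
            · simp [h1]
            · refine mul_le_mul_of_nonneg_left ?_ (Nat.cast_nonneg _)
              rcases Nat.eq_zero_or_pos (∑ b ∈ (B a).erase a, I b ω) with h | h
              · have : N ω - 1 = W a ω := by omega
                rw [this, sub_self, abs_zero]
                exact Nat.cast_nonneg _
              · exact (hdiff _ _).trans (by exact_mod_cast h)
        _ = ((B a).erase a).card * q ^ 2 := by
            rw [integral_finsetSum _ fun b _ => hIIint a b]
            rw [Finset.sum_congr rfl (g := fun _ => q ^ 2)]
            · simp
            · intro b hb
              rw [Finset.mem_erase] at hb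
              rw [hIIR, integral_indicator_one ((hA a).inter (hA b)), hpair a b hb.2 hb.1]
        _ ≤ M * q ^ 2 := by
            gcongr
            refine le_trans ?_ (hM a)
            exact_mod_cast Finset.card_le_card (Finset.erase_subset _ _)
    rw [integral_sub (hint _ hNm g hg0 hg1) (hint _ (hWm a) g hg0 hg1)] at b1
    rw [integral_sub (hIg a (fun ω => N ω - 1) (hNm.sub_const 1)) (hIg a _ (hWm a)), e1] at b2
    have b1' := mul_le_mul_of_nonneg_left b1 hq0
    rw [← abs_of_nonneg hq0, ← abs_mul, abs_of_nonneg hq0] at b1'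
    rw [abs_le] at *
    constructor <;> nlinarith
  have hset : {ω | ∀ a, ω ∉ A a} = {ω | N ω = 0} := by
    ext ω
    simp [hN, hI]
  have hmain : P.real {ω | ∀ a, ω ∉ A a} - Real.exp (-lam) =
      ∑ a, (q * ∫ ω, g (N ω) ∂P - ∫ ω, (I a ω : ℝ) * g (N ω - 1) ∂P) := by
    have hms : MeasurableSet {ω | N ω = 0} := hNm (measurableSet_singleton 0)
    rw [Finset.sum_sub_distrib, Finset.sum_const, Finset.card_univ, nsmul_eq_mul, ← mul_assoc,
      ← hlam, ← integral_const_mul, ← integral_finsetSum _ fun a _ =>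
        hIg a (fun ω => N ω - 1) (hNm.sub_const 1), ← integral_sub
        ((hint _ hNm g hg0 hg1).const_mul lam)
        (integrable_finsetSum _ fun a _ => hIg a (fun ω => N ω - 1) (hNm.sub_const 1)), hset,
      ← integral_indicator_one hms]
    have : Real.exp (-lam) = ∫ _, Real.exp (-lam) ∂P := by simp
    have hi : Integrable ({ω | N ω = 0}.indicator (1 : Ω → ℝ)) P :=
      (integrable_const (1 : ℝ)).indicator hms
    rw [this, ← integral_sub hi (integrable_const _)]
    congr 1
    ext ω
    rw [← Finset.sum_mul, ← Nat.cast_sum, ← steinSol_equation lam (N ω)]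
    simp [Set.indicator_apply]
  rw [hmain]
  refine (Finset.abs_sum_le_sum_abs _ _).trans ?_
  refine (Finset.sum_le_sum fun a _ => hstep a).trans ?_
  simp

/-! ### Angles under reflection invariant laws -/

section Sphere

variable {E : Type*} [NormedAddCommGroup E] [InnerProductSpace ℝ E]

/-- The absolute cosine of the angle between two vectors. -/
noncomputable def absCos (x y : E) : ℝ := |inner ℝ x y| / (‖x‖ * ‖y‖)

lemma absCos_comm (x y : E) : absCos x y = absCos y x := by
  rw [absCos, absCos, real_inner_comm, mul_comm]

lemma absCos_le_one (x y : E) : absCos x y ≤ 1 :=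
  div_le_one_of_le₀ (abs_real_inner_le_norm x y) (by positivity)

lemma absCos_map (f : E ≃ₗᵢ[ℝ] E) (x y : E) : absCos (f x) (f y) = absCos x y := by
  simp [absCos]

lemma absCos_smul_left {c : ℝ} (hc : c ≠ 0) (x y : E) : absCos (c • x) y = absCos x y := by
  rw [absCos, absCos, real_inner_smul_left, abs_mul, norm_smul, Real.norm_eq_abs, mul_assoc,
    mul_div_mul_left _ _ (abs_ne_zero.mpr hc)]

variable [MeasurableSpace E] [BorelSpace E] [FiniteDimensional ℝ E]

lemma measurable_absCos {α : Type*} [MeasurableSpace α] {f g : α → E} (hf : Measurable f)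
    (hg : Measurable g) : Measurable fun a => absCos (f a) (g a) := by
  unfold absCos
  exact (hf.inner hg (𝕜 := ℝ)).norm.div (hf.norm.mul hg.norm)

lemma measurableSet_le_absCos (t : ℝ) (x : E) : MeasurableSet {y | t ≤ absCos x y} :=
  measurableSet_le measurable_const (measurable_absCos measurable_const measurable_id)

/-- A measure is invariant under all reflections in hyperplanes through the origin. -/
def ReflectionInvariant (μ : Measure E) : Prop :=
  ∀ v : E, μ.map (Submodule.reflection (ℝ ∙ v)ᗮ) = μ

/-- Two unit vectors `u`, `u'` are exchanged by the reflection in the hyperplane orthogonal to `u -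
u'`. This is why reflections suffice in place of the whole orthogonal group. -/
lemma ReflectionInvariant.measure_le_absCos_eq {μ : Measure E} (hμ : ReflectionInvariant μ)
    (t : ℝ) {x x' : E} (hx : x ≠ 0) (hx' : x' ≠ 0) :
    μ {y | t ≤ absCos x y} = μ {y | t ≤ absCos x' y} := by
  have hn : ∀ z : E, z ≠ 0 → ‖‖z‖⁻¹ • z‖ = 1 := fun z hz => by
    rw [norm_smul, norm_inv, norm_norm, inv_mul_cancel₀ (norm_ne_zero_iff.mpr hz)]
  have key : ∀ z y : E, z ≠ 0 → absCos (‖z‖⁻¹ • z) y = absCos z y := fun z y hz =>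
    absCos_smul_left (inv_ne_zero (norm_ne_zero_iff.mpr hz)) z y
  set u := ‖x‖⁻¹ • x with hu
  set u' := ‖x'‖⁻¹ • x' with hu'
  have huu : ‖u‖ = ‖u'‖ := by rw [hn x hx, hn x' hx']
  have hm : MeasurableSet {y | t ≤ absCos u' y} := measurableSet_le_absCos t u'
  have e1 : {y | t ≤ absCos x y} = {y | t ≤ absCos u y} := by
    ext y; simp only [Set.mem_ofPred_eq, hu, key x y hx]
  have e2 : {y | t ≤ absCos x' y} = {y | t ≤ absCos u' y} := by
    ext y; simp only [Set.mem_ofPred_eq, hu', key x' y hx']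
  rw [e1, e2]
  conv_rhs => rw [← hμ (u - u')]
  rw [Measure.map_apply (by fun_prop) hm]
  congr 1
  ext y
  simp only [Set.mem_ofPred_eq, Set.mem_preimage]
  have h := absCos_map (Submodule.reflection (ℝ ∙ (u - u'))ᗮ) u y
  rw [Submodule.reflection_sub huu] at h
  rw [h]

/-- The probability that a random vector makes a small angle with a given direction is the same
for all reflection invariant laws without mass at the origin. -/
lemma ReflectionInvariant.measure_le_absCos_eq_of_prob {μ ν : Measure E}
    [IsProbabilityMeasure μ] [IsProbabilityMeasure ν]
    (hμ : ReflectionInvariant μ) (hν : ReflectionInvariant ν) (hμ0 : μ {0} = 0) (hν0 : ν {0} = 0)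
    (t : ℝ) {x : E} (hx : x ≠ 0) :
    μ {y | t ≤ absCos x y} = ν {y | t ≤ absCos x y} := by
  have hμ1 : ∀ᵐ y ∂μ, y ≠ 0 := by simpa [ae_iff] using hμ0
  have hν1 : ∀ᵐ y ∂ν, y ≠ 0 := by simpa [ae_iff] using hν0
  have hs : MeasurableSet {z : E × E | t ≤ absCos z.1 z.2} :=
    measurableSet_le measurable_const (measurable_absCos measurable_fst measurable_snd)
  -- The product measure of a symmetric event is computed in both orders. The inner integral is
  -- constant each time, by independence of the direction.
  have h1 : (μ.prod ν) {z : E × E | t ≤ absCos z.1 z.2} = ν {y | t ≤ absCos x y} := by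
    rw [Measure.prod_apply hs, lintegral_congr_ae (g := fun _ => ν {y | t ≤ absCos x y})]
    · simp
    · filter_upwards [hμ1] with y hy
      exact hν.measure_le_absCos_eq t hy hx
  have h2 : (μ.prod ν) {z : E × E | t ≤ absCos z.1 z.2} = μ {y | t ≤ absCos x y} := by
    rw [Measure.prod_apply_symm hs, lintegral_congr_ae (g := fun _ => μ {y | t ≤ absCos x y})]
    · simp
    · filter_upwards [hν1] with y hy
      rw [← hμ.measure_le_absCos_eq t hy hx]
      congr 1
      ext z
      simp [absCos_comm]
  rw [← h1, h2]

end Sphere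

/-! ### Exact probability of a small angle -/

section Cap

/-- The probability that the angle between a uniformly distributed direction in `ℝ^(m+1)` and a
fixed line has cosine at least `t`. -/
noncomputable def capProb (m : ℕ) (t : ℝ) : ℝ :=
  2 * (Real.Gamma (((m + 1 : ℕ) : ℝ) / 2 + 1) / (√Real.pi * Real.Gamma ((m : ℝ) / 2 + 1))) *
    (√(1 - t ^ 2) ^ m * t / (m + 1) + ∫ z in t..1, √(1 - z ^ 2) ^ m)

lemma capProb_one {m : ℕ} (hm : m ≠ 0) : capProb m 1 = 0 := by
  simp [capProb, hm]

/-- On [0, t] the cone bounds the slice and gives the elementary term; on [t, 1] the sphere does.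
Beyond 1 the square root of a negative number is 0, and `m ≠ 0` makes its power vanish. -/
lemma integral_min_pow {m : ℕ} (hm : m ≠ 0) {t : ℝ} (ht : 0 < t) (ht1 : t ≤ 1) :
    Integrable (fun z : ℝ => min (√(1 - t ^ 2) / t * |z|) √(1 - z ^ 2) ^ m) ∧
    ∫ z : ℝ, min (√(1 - t ^ 2) / t * |z|) √(1 - z ^ 2) ^ m =
      2 * (√(1 - t ^ 2) ^ m * t / (m + 1) + ∫ z in t..1, √(1 - z ^ 2) ^ m) := by
  set r := √(1 - t ^ 2) / t with hr
  have hr0 : 0 ≤ r := by positivity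
  have hrt : r * t = √(1 - t ^ 2) := by rw [hr]; field_simp
  have h1t : 0 ≤ 1 - t ^ 2 := by nlinarith
  have hzero : ∀ z : ℝ, 0 ≤ z → 1 ≤ z → min (r * z) √(1 - z ^ 2) ^ m = 0 := by
    intro z hz0 hz
    have : √(1 - z ^ 2) = 0 := Real.sqrt_eq_zero_of_nonpos (by nlinarith)
    rw [this, min_eq_right (by positivity), zero_pow hm]
  constructor
  · apply Continuous.integrable_of_hasCompactSupport (by fun_prop)
    refine HasCompactSupport.intro (isCompact_Icc (a := (-1 : ℝ)) (b := 1)) fun z hz => ?_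
    rw [← sq_abs z]
    apply hzero _ (abs_nonneg z)
    by_contra! h
    exact hz (abs_le.mp h.le)
  · have h1 := integral_comp_abs (f := fun z : ℝ => min (r * z) √(1 - z ^ 2) ^ m)
    simp only [sq_abs] at h1
    rw [h1]
    congr 1
    rw [setIntegral_eq_of_subset_of_forall_sdiff_eq_zero measurableSet_Ioi
      (s := Set.Ioc 0 1) Set.Ioc_subset_Ioi_self, ← intervalIntegral.integral_of_le zero_le_one,
      ← intervalIntegral.integral_add_adjacent_intervals (b := t)
        (Continuous.intervalIntegrable (by fun_prop) _ _)
        (Continuous.intervalIntegrable (by fun_prop) _ _)]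
    · congr 1
      · rw [intervalIntegral.integral_congr (g := fun z => r ^ m * z ^ m),
          intervalIntegral.integral_const_mul, integral_pow, ← hrt]
        · simp; ring
        · intro z hz
          rw [Set.uIcc_of_le ht.le] at hz
          have : r * z ≤ √(1 - z ^ 2) := by
            calc r * z ≤ r * t := by gcongr; exact hz.2
              _ = √(1 - t ^ 2) := hrt
              _ ≤ √(1 - z ^ 2) := by
                apply Real.sqrt_le_sqrt
                nlinarith [hz.1, hz.2]
          simp only [min_eq_left this, mul_pow]
      · apply intervalIntegral.integral_congr
        intro z hz
        rw [Set.uIcc_of_le ht1] at hz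
        have : √(1 - z ^ 2) ≤ r * z := by
          calc √(1 - z ^ 2) ≤ √(1 - t ^ 2) := by
                apply Real.sqrt_le_sqrt
                nlinarith [hz.1, hz.2]
            _ = r * t := hrt.symm
            _ ≤ r * z := by gcongr; exact hz.1
        simp only [min_eq_right this]
    · intro z hz
      have hz0 : 0 < z := hz.1
      apply hzero z hz0.le
      by_contra! h
      exact hz.2 ⟨hz0, h.le⟩

/-- Squaring turns the cone condition into t²‖v‖² ≤ (1 - t²)z². The height `z = 0` is excluded
because the origin has `absCos` equal to 0 by the division convention, while the right side would
still contain it. -/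
lemma slice_eq {F : Type*} [NormedAddCommGroup F] [InnerProductSpace ℝ F] {t : ℝ} (ht : 0 < t)
    (ht1 : t ≤ 1) {z : ℝ} (hz : z ≠ 0) (hz1 : |z| ≤ 1) :
    {v : F | WithLp.toLp 2 (z, v) ∈ Metric.closedBall (0 : WithLp 2 (ℝ × F)) 1 ∧
      t ≤ absCos (WithLp.toLp 2 ((1 : ℝ), (0 : F))) (WithLp.toLp 2 (z, v))} =
    Metric.closedBall 0 (min (√(1 - t ^ 2) / t * |z|) √(1 - z ^ 2)) := by
  ext v
  have hz0 : 0 < |z| := abs_pos.mpr hz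
  have hnsq : ‖WithLp.toLp 2 (z, v)‖ ^ 2 = z ^ 2 + ‖v‖ ^ 2 := by
    rw [WithLp.prod_norm_sq_eq_of_L2]; simp
  have he : ‖WithLp.toLp 2 ((1 : ℝ), (0 : F))‖ = 1 := by
    rw [← sq_eq_sq₀ (norm_nonneg _) zero_le_one, WithLp.prod_norm_sq_eq_of_L2]; simp
  have hin : inner ℝ (WithLp.toLp 2 ((1 : ℝ), (0 : F))) (WithLp.toLp 2 (z, v)) = z := by
    simp [WithLp.prod_inner_apply]
  set w := WithLp.toLp 2 (z, v) with hw
  have hwpos : 0 < ‖w‖ := by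
    by_contra! h
    have h0 : ‖w‖ = 0 := le_antisymm h (norm_nonneg _)
    rw [h0] at hnsq
    have : 0 < z ^ 2 := by positivity
    nlinarith [sq_nonneg ‖v‖]
  have hr : √(1 - t ^ 2) / t * |z| = √((1 - t ^ 2) * z ^ 2) / t := by
    rw [Real.sqrt_mul' _ (sq_nonneg z), Real.sqrt_sq_eq_abs]; ring
  have hz2 : z ^ 2 ≤ 1 := by rw [← sq_abs]; nlinarith
  have ht2 : t ^ 2 ≤ 1 := by nlinarith
  rw [Set.mem_ofPred_eq, absCos, hin, he, one_mul, le_div_iff₀ hwpos, mem_closedBall_zero_iff,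
    mem_closedBall_zero_iff, le_min_iff, hr, le_div_iff₀ ht, Real.le_sqrt (by positivity)
    (mul_nonneg (by linarith) (sq_nonneg z)), Real.le_sqrt (norm_nonneg v) (by linarith), and_comm]
  apply and_congr
  · rw [← sq_le_sq₀ (by positivity) hz0.le, mul_pow, hnsq, sq_abs, mul_pow]
    constructor <;> intro h <;> nlinarith
  · rw [← sq_le_sq₀ (norm_nonneg _) zero_le_one, hnsq]
    constructor <;> intro h <;> linarith

lemma volume_closedBall_inter_le_absCos {m : ℕ} (hm : m ≠ 0) {t : ℝ} (ht : 0 < t) (ht1 : t ≤ 1) :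
    volume (Metric.closedBall (0 : WithLp 2 (ℝ × EuclideanSpace ℝ (Fin m))) 1 ∩
      {y | t ≤ absCos (WithLp.toLp 2 ((1 : ℝ), (0 : EuclideanSpace ℝ (Fin m)))) y}) =
    ENNReal.ofReal (2 * (√(1 - t ^ 2) ^ m * t / (m + 1) + ∫ z in t..1, √(1 - z ^ 2) ^ m)) *
      ENNReal.ofReal (√Real.pi ^ m / Real.Gamma ((m : ℝ) / 2 + 1)) := by
  have : Nonempty (Fin m) := Fin.pos_iff_nonempty.mp (Nat.pos_of_ne_zero hm)
  set S := Metric.closedBall (0 : WithLp 2 (ℝ × EuclideanSpace ℝ (Fin m))) 1 ∩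
      {y | t ≤ absCos (WithLp.toLp 2 ((1 : ℝ), (0 : EuclideanSpace ℝ (Fin m)))) y} with hS
  have hSm : MeasurableSet S := measurableSet_closedBall.inter (measurableSet_le_absCos _ _)
  rw [← (WithLp.volume_preserving_toLp ℝ (EuclideanSpace ℝ (Fin m))).measure_preimage
    hSm.nullMeasurableSet, Measure.volume_eq_prod, Measure.prod_apply
    ((WithLp.measurable_toLp 2 _) hSm)]
  obtain ⟨hi, he⟩ := integral_min_pow hm ht ht1
  rw [← he, ofReal_integral_eq_lintegral_ofReal hi, ← lintegral_mul_const']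
  · apply lintegral_congr_ae
    have h0 : ∀ᵐ z : ℝ, z ≠ 0 := by simp [ae_iff]
    filter_upwards [h0] with z hz
    have hmin : 0 ≤ min (√(1 - t ^ 2) / t * |z|) √(1 - z ^ 2) := by positivity
    rw [ENNReal.ofReal_pow hmin]
    rcases le_or_gt |z| 1 with hz1 | hz1
    · have h := slice_eq (F := EuclideanSpace ℝ (Fin m)) ht ht1 hz hz1
      have h' : Prod.mk z ⁻¹' (WithLp.toLp 2 ⁻¹' S) =
        {v | WithLp.toLp 2 (z, v) ∈
            Metric.closedBall (0 : WithLp 2 (ℝ × EuclideanSpace ℝ (Fin m))) 1 ∧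
          t ≤ absCos (WithLp.toLp 2 ((1 : ℝ), (0 : EuclideanSpace ℝ (Fin m))))
            (WithLp.toLp 2 (z, v))} := rfl
      rw [h', h, EuclideanSpace.volume_closedBall, Fintype.card_fin]
    · have h : Prod.mk z ⁻¹' (WithLp.toLp 2 ⁻¹' S) = ∅ := by
        ext v
        simp only [Set.mem_preimage, Set.mem_empty_iff_false, iff_false]
        rintro ⟨hv, -⟩
        rw [mem_closedBall_zero_iff] at hv
        have := WithLp.prod_norm_sq_eq_of_L2 (WithLp.toLp 2 (z, v))
        change _ = ‖z‖ ^ 2 + ‖v‖ ^ 2 at this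
        rw [Real.norm_eq_abs] at this
        nlinarith [sq_nonneg ‖v‖, norm_nonneg (WithLp.toLp 2 (z, v))]
      have h2 : √(1 - z ^ 2) = 0 := by
        apply Real.sqrt_eq_zero_of_nonpos
        rw [← sq_abs]; nlinarith
      rw [h, h2, min_eq_right (by positivity)]
      simp [hm]
  · exact ENNReal.ofReal_ne_top
  · filter_upwards with z
    positivity

/-- The uniform law on the unit ball is the reference law: angle probabilities do not depend on the
invariant law, and for this one they are volumes. -/
lemma reflectionInvariant_cond_closedBall {E : Type*} [NormedAddCommGroup E]
    [InnerProductSpace ℝ E] [MeasurableSpace E] [BorelSpace E] [FiniteDimensional ℝ E] :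
    ReflectionInvariant (cond volume (Metric.closedBall (0 : E) 1)) := by
  intro v
  set f := Submodule.reflection (ℝ ∙ v)ᗮ
  ext S hS
  rw [Measure.map_apply (by fun_prop) hS, cond_apply measurableSet_closedBall,
    cond_apply measurableSet_closedBall]
  congr 1
  have h : Metric.closedBall (0 : E) 1 ∩ f ⁻¹' S = f ⁻¹' (Metric.closedBall (0 : E) 1 ∩ S) := by
    ext; simp
  rw [h, f.measurePreserving.measure_preimage (measurableSet_closedBall.inter hS).nullMeasurableSet]

/-- The exact probability that a random vector with a reflection invariant law makes a small angle
with a given direction. -/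
theorem ReflectionInvariant.measureReal_le_absCos {E : Type*} [NormedAddCommGroup E]
    [InnerProductSpace ℝ E] [MeasurableSpace E] [BorelSpace E] [FiniteDimensional ℝ E] {m : ℕ}
    (hm : m ≠ 0) (hE : Module.finrank ℝ E = m + 1) {μ : Measure E} [IsProbabilityMeasure μ]
    (hμ : ReflectionInvariant μ) (hμ0 : μ {0} = 0) {t : ℝ} (ht : 0 < t) (ht1 : t ≤ 1)
    {x : E} (hx : x ≠ 0) :
    μ.real {y | t ≤ absCos x y} = capProb m t := by
  have hnt : Nontrivial E := Module.nontrivial_of_finrank_pos (R := ℝ) (by omega)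
  have hW : Module.finrank ℝ (WithLp 2 (ℝ × EuclideanSpace ℝ (Fin m))) = m + 1 := by
    rw [(WithLp.linearEquiv 2 ℝ _).finrank_eq]
    simp [add_comm]
  set φ : WithLp 2 (ℝ × EuclideanSpace ℝ (Fin m)) ≃ₗᵢ[ℝ] E :=
    (stdOrthonormalBasis ℝ _).equiv (stdOrthonormalBasis ℝ E) (finCongr (hW.trans hE.symm))
  set e : WithLp 2 (ℝ × EuclideanSpace ℝ (Fin m)) := WithLp.toLp 2 (1, 0) with he
  have he0 : e ≠ 0 := by
    intro h
    have := congrArg (fun w => (WithLp.ofLp w).1) h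
    simp [he] at this
  have hφe : φ e ≠ 0 := by simpa using he0
  have hball : volume (Metric.closedBall (0 : E) 1) =
      ENNReal.ofReal (√Real.pi ^ (m + 1) / Real.Gamma (((m + 1 : ℕ) : ℝ) / 2 + 1)) := by
    rw [InnerProductSpace.volume_closedBall, hE]; simp
  have hν : IsProbabilityMeasure (cond volume (Metric.closedBall (0 : E) 1)) :=
    cond_isProbabilityMeasure_of_finite
      (by rw [hball]; simp; positivity) (by rw [hball]; exact ENNReal.ofReal_ne_top)
  rw [measureReal_def, hμ.measure_le_absCos_eq t hx hφe,
    hμ.measure_le_absCos_eq_of_prob reflectionInvariant_cond_closedBall hμ0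
      (by rw [cond_apply measurableSet_closedBall]; simp [Set.inter_singleton_of_mem]) t hφe,
    cond_apply measurableSet_closedBall, hball]
  have hpre : φ ⁻¹' (Metric.closedBall (0 : E) 1 ∩ {y | t ≤ absCos (φ e) y}) =
      Metric.closedBall 0 1 ∩ {y | t ≤ absCos e y} := by
    ext y
    simp [absCos, φ.inner_map_map]
  rw [← φ.measurePreserving.measure_preimage
    (measurableSet_closedBall.inter (measurableSet_le_absCos t _)).nullMeasurableSet, hpre,
    volume_closedBall_inter_le_absCos hm ht ht1]
  have hG1 : 0 < Real.Gamma (((m + 1 : ℕ) : ℝ) / 2 + 1) := Real.Gamma_pos_of_pos (by positivity)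
  have hG2 : 0 < Real.Gamma ((m : ℝ) / 2 + 1) := Real.Gamma_pos_of_pos (by positivity)
  have hI : 0 ≤ ∫ z in t..1, √(1 - z ^ 2) ^ m :=
    intervalIntegral.integral_nonneg ht1 fun z _ => by positivity
  rw [ENNReal.toReal_mul, ENNReal.toReal_mul, ENNReal.toReal_inv, ENNReal.toReal_ofReal
    (by positivity), ENNReal.toReal_ofReal (by positivity), ENNReal.toReal_ofReal (by positivity),
    capProb]
  have hpi : 0 < √Real.pi := by positivity
  field_simp
  ring

end Cap

/-! ### Asymptotics of the cap probability at the threshold -/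

section Asymptotics

/-- Inserting the factor z/t ≥ 1 makes the integrand an exact derivative. The denominator `m + 2` is
weakened to `m + 1` to match the conical term, against which the integral is smaller by a factor (1
- t²)/t². -/
lemma integral_sqrt_one_sub_sq_pow_le (m : ℕ) {t : ℝ} (ht : 0 < t) (ht1 : t ≤ 1) :
    ∫ z in t..1, √(1 - z ^ 2) ^ m ≤ √(1 - t ^ 2) ^ m * ((1 - t ^ 2) / t) / (m + 1) := by
  have h1 : ∫ z in t..1, √(1 - z ^ 2) ^ m ≤ ∫ z in t..1, t⁻¹ * (z * √(1 - z ^ 2) ^ m) := by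
    apply intervalIntegral.integral_mono_on ht1
    · exact Continuous.intervalIntegrable (by fun_prop) _ _
    · exact Continuous.intervalIntegrable (by fun_prop) _ _
    · intro z hz
      rw [← mul_assoc]
      apply le_mul_of_one_le_left (by positivity)
      rw [inv_mul_eq_div, one_le_div ht]
      exact hz.1
  have h2 : ∫ z in t..1, z * √(1 - z ^ 2) ^ m = √(1 - t ^ 2) ^ (m + 2) / (m + 2) := by
    rw [intervalIntegral.integral_eq_sub_of_hasDerivAt_of_le
      (f := fun z => -(√(1 - z ^ 2) ^ (m + 2) / (m + 2))) ht1
      (Continuous.continuousOn (by fun_prop)) ?_ (Continuous.intervalIntegrable (by fun_prop) _ _)]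
    · simp
    · intro z hz
      have hpos : 0 < 1 - z ^ 2 := by nlinarith [hz.1, hz.2]
      have hs : 0 < √(1 - z ^ 2) := Real.sqrt_pos.mpr hpos
      have hd := ((((hasDerivAt_pow 2 z).const_sub 1).sqrt hpos.ne').pow (m + 2)).div_const
        ((m : ℝ) + 2) |>.neg
      convert! hd using 1
      push_cast
      field_simp
      ring_nf
  rw [intervalIntegral.integral_const_mul, h2] at h1
  refine h1.trans ?_
  have hs : √(1 - t ^ 2) ^ (m + 2) = √(1 - t ^ 2) ^ m * (1 - t ^ 2) := by
    rw [pow_add, Real.sq_sqrt (by nlinarith)]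
  have h0 : 0 ≤ √(1 - t ^ 2) ^ m * (1 - t ^ 2) := by
    have : 0 ≤ 1 - t ^ 2 := by nlinarith
    positivity
  calc t⁻¹ * (√(1 - t ^ 2) ^ (m + 2) / (m + 2))
      = (√(1 - t ^ 2) ^ m * (1 - t ^ 2) / t) / (m + 2) := by rw [hs]; ring
    _ ≤ (√(1 - t ^ 2) ^ m * (1 - t ^ 2) / t) / (m + 1) := by
        gcongr
        norm_num
    _ = _ := by ring

/-- Log-convexity of Γ at the midpoint of x and x + 1. -/
lemma Gamma_add_half_sq_le {x : ℝ} (hx : 0 < x) :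
    Real.Gamma (x + 1 / 2) ^ 2 ≤ x * Real.Gamma x ^ 2 := by
  have h := Real.Gamma_mul_add_mul_le_rpow_Gamma_mul_rpow_Gamma hx (show 0 < x + 1 by linarith)
    (a := 1 / 2) (b := 1 / 2) (by norm_num) (by norm_num) (by norm_num)
  rw [show 1 / 2 * x + 1 / 2 * (x + 1) = x + 1 / 2 by ring, Real.Gamma_add_one hx.ne',
    ← Real.sqrt_eq_rpow, ← Real.sqrt_eq_rpow] at h
  have hG := Real.Gamma_pos_of_pos hx
  have hG2 := Real.Gamma_pos_of_pos (show 0 < x + 1 / 2 by linarith)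
  calc Real.Gamma (x + 1 / 2) ^ 2 ≤ (√(Real.Gamma x) * √(x * Real.Gamma x)) ^ 2 := by gcongr
    _ = x * Real.Gamma x ^ 2 := by
      rw [mul_pow, Real.sq_sqrt hG.le, Real.sq_sqrt (by positivity)]; ring

/-- The previous bound at x + 1/2, together with Γ(x + 1) = xΓ(x). -/
lemma le_Gamma_add_half_sq {x : ℝ} (hx : 0 < x) :
    x ^ 2 / (x + 1 / 2) * Real.Gamma x ^ 2 ≤ Real.Gamma (x + 1 / 2) ^ 2 := by
  have h := Gamma_add_half_sq_le (show 0 < x + 1 / 2 by linarith)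
  rw [show x + 1 / 2 + 1 / 2 = x + 1 by ring, Real.Gamma_add_one hx.ne'] at h
  rw [div_mul_eq_mul_div, div_le_iff₀ (by linarith)]
  nlinarith

lemma tendsto_Gamma_ratio :
    Tendsto (fun n : ℕ => Real.Gamma ((n + 1) / 2) / Real.Gamma (n / 2) * √n / (n - 1)) atTop
      (𝓝 (√2)⁻¹) := by
  have hsq : Tendsto (fun n : ℕ =>
      (Real.Gamma ((n + 1) / 2) / Real.Gamma (n / 2) * √n / ((n : ℝ) - 1)) ^ 2) atTop
      (𝓝 (1 / 2)) := by
    have hinv : Tendsto (fun n : ℕ => ((n : ℝ))⁻¹) atTop (𝓝 0) :=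
      tendsto_inv_atTop_zero.comp tendsto_natCast_atTop_atTop
    have hlo : Tendsto (fun n : ℕ => 1 / (2 * (1 + (n : ℝ)⁻¹) * (1 - (n : ℝ)⁻¹) ^ 2)) atTop
        (𝓝 (1 / (2 * (1 + 0) * (1 - 0) ^ 2))) := by
      refine Tendsto.div tendsto_const_nhds ?_ (by norm_num)
      exact ((hinv.const_add 1).const_mul 2).mul ((hinv.const_sub 1).pow 2)
    have hhi : Tendsto (fun n : ℕ => 1 / (2 * (1 - (n : ℝ)⁻¹) ^ 2)) atTop
        (𝓝 (1 / (2 * (1 - 0) ^ 2))) := by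
      refine Tendsto.div tendsto_const_nhds ?_ (by norm_num)
      exact ((hinv.const_sub 1).pow 2).const_mul 2
    norm_num at hlo hhi
    have hev : ∀ᶠ n : ℕ in atTop, 2 ≤ n := eventually_ge_atTop 2
    refine tendsto_of_tendsto_of_tendsto_of_le_of_le' (by convert hlo using 2)
      (by convert hhi using 2) ?_ ?_
    all_goals
      filter_upwards [hev] with n hn
      have hn' : (2 : ℝ) ≤ n := by exact_mod_cast hn
      have hx : (0 : ℝ) < n / 2 := by positivity
      have hG := Real.Gamma_pos_of_pos hx
      have h1 := le_Gamma_add_half_sq hx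
      have h2 := Gamma_add_half_sq_le hx
      rw [show (n : ℝ) / 2 + 1 / 2 = (n + 1) / 2 by ring] at h1 h2
      rw [div_pow, mul_pow, div_pow, Real.sq_sqrt (by positivity)]
      have hn1 : (0 : ℝ) < n - 1 := by linarith
      have hG2 : 0 < Real.Gamma ((n : ℝ) / 2) ^ 2 := by positivity
    · rw [← le_div_iff₀ hG2] at h1
      have : ((n : ℝ) / 2) ^ 2 / ((n + 1) / 2) * n / (n - 1) ^ 2 ≤
        Real.Gamma ((n + 1) / 2) ^ 2 / Real.Gamma (n / 2) ^ 2 * n / (n - 1) ^ 2 := by gcongr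
      refine le_trans (le_of_eq ?_) this
      field_simp
    · rw [← div_le_iff₀ hG2] at h2
      have : Real.Gamma ((n + 1) / 2) ^ 2 / Real.Gamma (n / 2) ^ 2 * n / (n - 1) ^ 2 ≤
        (n : ℝ) / 2 * n / (n - 1) ^ 2 := by gcongr
      refine this.trans (le_of_eq ?_)
      field_simp
  have h := hsq.sqrt
  rw [show √(1 / 2) = (√2)⁻¹ by simp] at h
  refine h.congr' ?_
  filter_upwards [eventually_ge_atTop 1] with n hn
  apply Real.sqrt_sq
  have hn' : (1 : ℝ) ≤ n := by exact_mod_cast hn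
  have h1 := Real.Gamma_pos_of_pos (show (0 : ℝ) < n / 2 by positivity)
  have h2 := Real.Gamma_pos_of_pos (show (0 : ℝ) < (n + 1) / 2 by positivity)
  have h3 : (0 : ℝ) ≤ n - 1 := by linarith
  positivity

/-- The logarithm of the threshold for `1 - L ^ 2`. -/
noncomputable def logThreshold (p : ℕ → ℕ) (y : ℝ) (n : ℕ) : ℝ :=
  (y + Real.log n - 4 * n / ((n : ℝ) - 2) * Real.log (p n)) / n

/-- The threshold for the correlation coefficients. -/
noncomputable def corThreshold (p : ℕ → ℕ) (y : ℝ) (n : ℕ) : ℝ :=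
  √(1 - Real.exp (logThreshold p y n))

lemma tendsto_log_p {p : ℕ → ℕ}
    (hp : Tendsto (fun n : ℕ => Real.log (p n) / n) atTop atTop) : Tendsto (fun n => Real.log (p n)) atTop atTop := by
  refine tendsto_atTop_mono' _ ?_ hp
  filter_upwards [eventually_ge_atTop 1] with n hn
  exact div_le_self (Real.log_natCast_nonneg _) (by exact_mod_cast hn)

lemma tendsto_p {p : ℕ → ℕ}
    (hp : Tendsto (fun n : ℕ => Real.log (p n) / n) atTop atTop) : Tendsto p atTop atTop := by
  rw [← tendsto_natCast_atTop_iff (R := ℝ)]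
  refine tendsto_atTop_mono' _ ?_ (tendsto_log_p hp)
  filter_upwards with n
  exact Real.log_le_self (Nat.cast_nonneg _)

lemma tendsto_log_div_nat : Tendsto (fun n : ℕ => Real.log n / n) atTop (𝓝 0) := by
  exact Real.isLittleO_log_id_atTop.tendsto_div_nhds_zero.comp
    (tendsto_natCast_atTop_atTop (R := ℝ))

lemma tendsto_add_log_div_nat (y : ℝ) :
    Tendsto (fun n : ℕ => (y + Real.log n) / n) atTop (𝓝 0) := by
  have h := (tendsto_const_div_atTop_nhds_zero_nat y).add tendsto_log_div_nat
  simpa [add_div] using h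

/-- Here the super-exponential growth enters: it sends 1 - t² to 0, which makes the integral over
[t, 1] negligible. -/
lemma tendsto_logThreshold {p : ℕ → ℕ}
    (hp : Tendsto (fun n : ℕ => Real.log (p n) / n) atTop atTop) (y : ℝ) : Tendsto (logThreshold p y) atTop atBot := by
  have h := (tendsto_add_log_div_nat y).add_atBot
    (tendsto_neg_atTop_atBot.comp (hp.const_mul_atTop (show (0 : ℝ) < 4 by norm_num)))
  refine tendsto_atBot_mono' _ ?_ h
  filter_upwards [eventually_ge_atTop 3] with n hn
  have hn' : (3 : ℝ) ≤ n := by exact_mod_cast hn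
  have hl := Real.log_natCast_nonneg (p n)
  have h2 : (0 : ℝ) < n - 2 := by linarith
  have h3 : 4 * (Real.log (p n) / n) ≤ 4 * n / ((n : ℝ) - 2) * Real.log (p n) / n := by
    rw [mul_div_assoc]
    gcongr
    rw [le_div_iff₀ h2]
    linarith
  rw [logThreshold, sub_div]
  simp only [Function.comp_apply]
  linarith

lemma tendsto_exp_logThreshold {p : ℕ → ℕ}
    (hp : Tendsto (fun n : ℕ => Real.log (p n) / n) atTop atTop) (y : ℝ) :
    Tendsto (fun n => Real.exp (logThreshold p y n)) atTop (𝓝 0) :=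
  Real.tendsto_exp_atBot.comp (tendsto_logThreshold hp y)

lemma tendsto_corThreshold {p : ℕ → ℕ}
    (hp : Tendsto (fun n : ℕ => Real.log (p n) / n) atTop atTop) (y : ℝ) : Tendsto (corThreshold p y) atTop (𝓝 1) := by
  have h := ((tendsto_exp_logThreshold hp y).const_sub 1).sqrt
  rw [sub_zero, Real.sqrt_one] at h
  exact h

lemma tendsto_sq_mul_capProb {p : ℕ → ℕ}
    (hp : Tendsto (fun n : ℕ => Real.log (p n) / n) atTop atTop) (y : ℝ) :
    Tendsto (fun n => (p n : ℝ) ^ 2 / 2 * capProb (n - 2) (corThreshold p y n)) atTop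
      (𝓝 (1 / √(2 * Real.pi) * Real.exp (y / 2))) := by
  set t := corThreshold p y with htdef
  set ε : ℕ → ℝ := fun n => Real.exp (logThreshold p y n) with hε
  have hε0 : Tendsto ε atTop (𝓝 0) := tendsto_exp_logThreshold hp y
  have ht1 : Tendsto t atTop (𝓝 1) := tendsto_corThreshold hp y
  -- Everything except the geometric bracket t + (integral term). The integral term lies between 0
  -- and ε/t, where ε = 1 - t², so both bounds have the limit of `a`.
  set a : ℕ → ℝ := fun n => (Real.Gamma ((n + 1) / 2) / Real.Gamma (n / 2) * √n / (n - 1)) *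
    (√Real.pi)⁻¹ * Real.exp (y / 2 - (y + Real.log n) / n) with ha
  have ha_lim : Tendsto a atTop (𝓝 (1 / √(2 * Real.pi) * Real.exp (y / 2))) := by
    have h1 := (Real.continuous_exp.tendsto _).comp ((tendsto_add_log_div_nat y).const_sub (y / 2))
    have h2 := (tendsto_Gamma_ratio.mul_const (√Real.pi)⁻¹).mul h1
    convert! h2 using 2
    rw [Real.sqrt_mul (by norm_num), sub_zero]
    field_simp
  have hlo : Tendsto (fun n => a n * t n) atTop (𝓝 (1 / √(2 * Real.pi) * Real.exp (y / 2))) := by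
    simpa using ha_lim.mul ht1
  have hhi : Tendsto (fun n => a n * (t n + ε n / t n)) atTop
      (𝓝 (1 / √(2 * Real.pi) * Real.exp (y / 2))) := by
    simpa using ha_lim.mul (ht1.add (hε0.div ht1 one_ne_zero))
  have hform : ∀ᶠ n : ℕ in atTop, 0 < t n ∧ t n ≤ 1 ∧ 0 ≤ a n ∧
      (p n : ℝ) ^ 2 / 2 * capProb (n - 2) (t n) =
        a n * (t n + (n - 1) * (∫ z in (t n)..1, √(1 - z ^ 2) ^ (n - 2)) /
          √(1 - t n ^ 2) ^ (n - 2)) ∧ 1 - t n ^ 2 = ε n := by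
    filter_upwards [hε0.eventually_lt_const (show (0 : ℝ) < 1 by norm_num),
      eventually_ge_atTop 3, (tendsto_p hp).eventually_ge_atTop 1] with n hn1 hn hpn
    obtain ⟨m, rfl⟩ : ∃ m, n = m + 2 := ⟨n - 2, by omega⟩
    have hεpos : 0 < ε (m + 2) := Real.exp_pos _
    have ht0 : 0 < t (m + 2) := Real.sqrt_pos.mpr (by linarith)
    have htsq : 1 - t (m + 2) ^ 2 = ε (m + 2) := by
      rw [htdef, corThreshold, Real.sq_sqrt (by linarith)]; ring
    have hG1 : 0 < Real.Gamma (((m : ℝ) + 2 + 1) / 2) := Real.Gamma_pos_of_pos (by positivity)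
    have hG2 : 0 < Real.Gamma (((m : ℝ) + 2) / 2) := Real.Gamma_pos_of_pos (by positivity)
    have hp0 : (0 : ℝ) < p (m + 2) := by exact_mod_cast hpn
    -- With n = m + 2, the exponent (m/2) · 4n/(n-2) · (log p)/n equals 2 log p, so p² cancels
    -- exactly; the log n of the threshold leaves the factor √n.
    have hkey : (p (m + 2) : ℝ) ^ 2 * √(ε (m + 2)) ^ m =
        √((m + 2 : ℕ) : ℝ) * Real.exp (y / 2 - (y + Real.log (m + 2 : ℕ)) / (m + 2 : ℕ)) := by
      have e1 : (p (m + 2) : ℝ) ^ 2 = Real.exp (2 * Real.log (p (m + 2))) := by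
        rw [two_mul, Real.exp_add, Real.exp_log hp0]; ring
      have e2 : √(ε (m + 2)) ^ m = Real.exp (m * (logThreshold p y (m + 2) / 2)) := by
        rw [Real.exp_nat_mul, Real.exp_half]
      have e3 : √((m + 2 : ℕ) : ℝ) = Real.exp (Real.log (m + 2 : ℕ) / 2) := by
        rw [Real.exp_half, Real.exp_log (by positivity)]
      rw [e1, e2, e3, ← Real.exp_add, ← Real.exp_add, logThreshold]
      congr 1
      have hm : m ≠ 0 := by omega
      push_cast
      rw [show (m : ℝ) + 2 - 2 = m by ring]
      field_simp
      ring
    refine ⟨ht0, ?_, ?_, ?_, htsq⟩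
    · nlinarith
    · simp only [ha]
      push_cast
      have : (0 : ℝ) ≤ (m : ℝ) + 2 - 1 := by linarith [Nat.cast_nonneg (α := ℝ) m]
      positivity
    · rw [htsq, Nat.add_sub_cancel]
      have hs : 0 < √(ε (m + 2)) ^ m := by positivity
      have hpi : 0 < √Real.pi := by positivity
      simp only [ha]
      rw [capProb, htsq]
      have c1 : (((m + 1 : ℕ) : ℝ) / 2 + 1) = ((m : ℝ) + 2 + 1) / 2 := by push_cast; ring
      have c2 : ((m : ℝ) / 2 + 1) = ((m : ℝ) + 2) / 2 := by ring
      rw [c1, c2]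
      have hm1 : (0 : ℝ) < (m : ℝ) + 1 := by positivity
      have c3 : ((m + 2 : ℕ) : ℝ) - 1 = m + 1 := by push_cast; ring
      rw [c3]
      have hsplit : ∀ G I T : ℝ, G * √((m + 2 : ℕ) : ℝ) / (m + 1) * (√Real.pi)⁻¹ *
          Real.exp (y / 2 - (y + Real.log (m + 2 : ℕ)) / (m + 2 : ℕ)) *
            (T + (m + 1) * I / √(ε (m + 2)) ^ m) =
          G / (m + 1) * (√Real.pi)⁻¹ * ((p (m + 2) : ℝ) ^ 2 * √(ε (m + 2)) ^ m) *
            (T + (m + 1) * I / √(ε (m + 2)) ^ m) := by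
        intro G I T
        rw [hkey]; ring
      rw [hsplit]
      push_cast
      field_simp
  refine tendsto_of_tendsto_of_tendsto_of_le_of_le' hlo hhi ?_ ?_
  · filter_upwards [hform, eventually_ge_atTop 1] with n hn hn1
    obtain ⟨h0, h1, h2, h3, h4⟩ := hn
    rw [h3]
    have hI : 0 ≤ ∫ z in (t n)..1, √(1 - z ^ 2) ^ (n - 2) :=
      intervalIntegral.integral_nonneg h1 fun z _ => by positivity
    have : (0 : ℝ) ≤ n - 1 := by
      have : (1 : ℝ) ≤ n := by exact_mod_cast hn1
      linarith
    gcongr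
    rw [le_add_iff_nonneg_right]
    positivity
  · filter_upwards [hform, eventually_ge_atTop 3] with n hn hn1
    obtain ⟨h0, h1, h2, h3, h4⟩ := hn
    rw [h3]
    refine mul_le_mul_of_nonneg_left (add_le_add_right ?_ _) h2
    have hI := integral_sqrt_one_sub_sq_pow_le (n - 2) h0 h1
    have hc : ((n - 2 : ℕ) : ℝ) + 1 = n - 1 := by
      rw [Nat.cast_sub (by omega)]; push_cast; ring
    have hn' : (0 : ℝ) < n - 1 := by
      have : (3 : ℝ) ≤ n := by exact_mod_cast hn1
      linarith
    rw [hc, le_div_iff₀ hn', h4] at hI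
    have hs : 0 < √(ε n) ^ (n - 2) := by
      have : 0 < ε n := Real.exp_pos _
      positivity
    rw [h4, div_le_iff₀ hs]
    linarith

end Asymptotics

/-! ### From distribution functions to weak convergence -/

section WeakConvergence

/-- Half-open intervals form a π-system containing small neighbourhoods of every point, so
convergence of their measures is enough. -/
lemma tendstoInDistribution_of_tendsto_cdf {Ω : ℕ → Type*} [∀ n, MeasurableSpace (Ω n)]
    {P : ∀ n, Measure (Ω n)} [∀ n, IsProbabilityMeasure (P n)] {Y : ∀ n, Ω n → ℝ}
    (hY : ∀ n, AEMeasurable (Y n) (P n)) {ν : Measure ℝ} [IsProbabilityMeasure ν]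
    (h : ∀ y, Tendsto (fun n => (P n).real {ω | Y n ω ≤ y}) atTop (𝓝 (cdf ν y))) :
    TendstoInDistribution Y atTop (id : ℝ → ℝ) P ν := by
  refine ⟨hY, aemeasurable_id, ?_⟩
  refine (isPiSystem_Ioc (id : ℝ → ℝ) id).tendsto_probabilityMeasure_of_tendsto_of_mem ?_ ?_ ?_
  · rintro s ⟨a, b, -, rfl⟩
    exact measurableSet_Ioc
  · intro u hu x hx
    obtain ⟨ε, hε, hb⟩ := Metric.isOpen_iff.mp hu x hx
    refine ⟨_, ⟨x - ε / 2, x + ε / 2, by simp; linarith, rfl⟩,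
      Ioc_mem_nhds (by simp; linarith) (by simp; linarith), fun z hz => hb ?_⟩
    simp only [id, Set.mem_Ioc] at hz
    rw [Metric.mem_ball, Real.dist_eq, abs_lt]
    constructor <;> linarith
  · rintro s ⟨a, b, hab, rfl⟩
    simp only [id] at hab ⊢
    have hIoc : ∀ (μ : Measure ℝ) [IsProbabilityMeasure μ],
        μ.real (Set.Ioc a b) = μ.real (Set.Iic b) - μ.real (Set.Iic a) := by
      intro μ _
      rw [← Set.Iic_sdiff_Iic, measureReal_sdiff (Set.Iic_subset_Iic.mpr hab.le) measurableSet_Iic]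
    rw [← NNReal.tendsto_coe]
    have hc : ∀ y, cdf ν y = ν.real (Set.Iic y) := cdf_eq_real ν
    have hlim := (h b).sub (h a)
    rw [hc, hc, ← hIoc] at hlim
    convert! hlim using 2 with n
    · have : IsProbabilityMeasure ((P n).map (Y n)) := Measure.isProbabilityMeasure_map (hY n)
      change ((P n).map (Y n)).real (Set.Ioc a b) = _
      rw [hIoc, map_measureReal_apply_of_aemeasurable (hY n) measurableSet_Iic,
        map_measureReal_apply_of_aemeasurable (hY n) measurableSet_Iic]
      rfl
    · change (ν.map id).real (Set.Ioc a b) = _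
      rw [Measure.map_id]

lemma tendsto_limitCDF_atBot (K : ℝ) :
    Tendsto (fun y : ℝ => 1 - Real.exp (-K * Real.exp (y / 2))) atBot (𝓝 0) := by
  have h := Real.tendsto_exp_atBot.comp (tendsto_id.atBot_div_const (show (0 : ℝ) < 2 by norm_num))
  have h2 := ((Real.continuous_exp.tendsto _).comp (h.const_mul (-K))).const_sub 1
  simpa using h2

lemma tendsto_limitCDF_atTop {K : ℝ} (hK : 0 < K) :
    Tendsto (fun y : ℝ => 1 - Real.exp (-K * Real.exp (y / 2))) atTop (𝓝 1) := by
  have h := Real.tendsto_exp_atTop.comp (tendsto_id.atTop_div_const (show (0 : ℝ) < 2 by norm_num))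
  have h2 := (Real.tendsto_exp_atBot.comp
    (h.const_mul_atTop_of_neg (neg_lt_zero.mpr hK))).const_sub 1
  simpa using h2

lemma exists_measure_limitCDF {K : ℝ} (hK : 0 < K) :
    ∃ (ν : Measure ℝ) (_ : IsProbabilityMeasure ν),
      ∀ y, cdf ν y = 1 - Real.exp (-K * Real.exp (y / 2)) := by
  let F : StieltjesFunction ℝ :=
    { toFun := fun y => 1 - Real.exp (-K * Real.exp (y / 2))
      mono' := by
        intro a b hab
        simp only [neg_mul]
        gcongr
      right_continuous' := fun y => Continuous.continuousWithinAt (by fun_prop) }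
  have h0 : Tendsto F atBot (𝓝 0) := tendsto_limitCDF_atBot K
  have h1 : Tendsto F atTop (𝓝 1) := tendsto_limitCDF_atTop hK
  exact ⟨F.measure, F.isProbabilityMeasure h0 h1, fun y => by
    rw [cdf_measure_stieltjesFunction F h0 h1]⟩

end WeakConvergence

/-! ### Combinatorics of index pairs -/

section Pairs

/-- The pairs `i < j` of indices below `p`. -/
abbrev IndexPair (p : ℕ) : Type := {q : Fin p × Fin p // q.1 < q.2}

lemma card_indexPair (p : ℕ) : (Fintype.card (IndexPair p) : ℝ) = p * (p - 1) / 2 := by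
  have h : Fintype.card (IndexPair p) = ∑ i : Fin p, (p - 1 - (i : ℕ)) := by
    rw [Fintype.card_subtype, ← Finset.univ_product_univ, Finset.card_filter, Finset.sum_product]
    refine Finset.sum_congr rfl fun i _ => ?_
    rw [← Fin.card_Ioi, ← Finset.card_filter]
    congr 1
    ext j; simp
  rw [h, Fin.sum_univ_eq_sum_range (fun i => p - 1 - i), Finset.sum_range_reflect (fun i => i)]
  have h2 := Finset.sum_range_id_mul_two p
  rw [eq_div_iff two_ne_zero]
  rcases p with _ | p
  · simp
  · have : ((∑ i ∈ Finset.range (p + 1), i : ℕ) : ℝ) * 2 = ((p + 1 : ℕ) : ℝ) * (p : ℕ) := by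
      exact_mod_cast h2
    rw [this]; push_cast; ring

/-- The pairs that share an index with `a`. -/
def IndexPair.neighbors {p : ℕ} (a : IndexPair p) : Finset (IndexPair p) :=
  Finset.univ.filter fun b => b.1.1 = a.1.1 ∨ b.1.1 = a.1.2 ∨ b.1.2 = a.1.1 ∨ b.1.2 = a.1.2

lemma IndexPair.card_neighbors_le {p : ℕ} (a : IndexPair p) : a.neighbors.card ≤ 4 * p := by
  have h1 : ∀ i : Fin p, (Finset.univ.filter fun b : IndexPair p => b.1.1 = i).card ≤ p := by
    intro i
    conv_rhs => rw [← Fintype.card_fin p, ← Finset.card_univ]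
    refine Finset.card_le_card_of_injOn (fun b => b.1.2) (fun _ _ => Finset.mem_univ _) ?_
    intro b hb c hc hbc
    simp only [Finset.coe_filter, Finset.mem_univ, true_and, Set.mem_ofPred_eq] at hb hc
    exact Subtype.ext (Prod.ext (hb.trans hc.symm) hbc)
  have h2 : ∀ i : Fin p, (Finset.univ.filter fun b : IndexPair p => b.1.2 = i).card ≤ p := by
    intro i
    conv_rhs => rw [← Fintype.card_fin p, ← Finset.card_univ]
    refine Finset.card_le_card_of_injOn (fun b => b.1.1) (fun _ _ => Finset.mem_univ _) ?_
    intro b hb c hc hbc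
    simp only [Finset.coe_filter, Finset.mem_univ, true_and, Set.mem_ofPred_eq] at hb hc
    exact Subtype.ext (Prod.ext hbc (hb.trans hc.symm))
  rw [neighbors, Finset.filter_or, Finset.filter_or, Finset.filter_or]
  have := h1 a.1.1
  have := h1 a.1.2
  have := h2 a.1.1
  have := h2 a.1.2
  refine (Finset.card_union_le _ _).trans ?_
  have i2 := Finset.card_union_le (Finset.univ.filter fun b : IndexPair p => b.1.1 = a.1.2)
    ((Finset.univ.filter fun b : IndexPair p => b.1.2 = a.1.1) ∪
      Finset.univ.filter fun b : IndexPair p => b.1.2 = a.1.2)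
  have i3 := Finset.card_union_le (Finset.univ.filter fun b : IndexPair p => b.1.2 = a.1.1)
    (Finset.univ.filter fun b : IndexPair p => b.1.2 = a.1.2)
  omega

end Pairs

/-! ### Poisson approximation for independent spherical vectors -/

section SphericalVectors

variable {E : Type*} [NormedAddCommGroup E] [InnerProductSpace ℝ E] [MeasurableSpace E]
  [BorelSpace E] [FiniteDimensional ℝ E] {Ω : Type*} [MeasurableSpace Ω] {P : Measure Ω}
  [IsProbabilityMeasure P] {m : ℕ} {t : ℝ}

lemma measureReal_le_absCos_pair (hm : m ≠ 0) (hE : Module.finrank ℝ E = m + 1) (ht : 0 < t)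
    (ht1 : t ≤ 1) {X Y : Ω → E} (hX : Measurable X) (hY : Measurable Y)
    (hXY : IndepFun X Y P) (hrY : ReflectionInvariant (P.map Y))
    (hX0 : P {ω | X ω = 0} = 0) (hY0 : P {ω | Y ω = 0} = 0) :
    P.real {ω | t ≤ absCos (X ω) (Y ω)} = capProb m t := by
  have := Measure.isProbabilityMeasure_map (μ := P) hX.aemeasurable
  have := Measure.isProbabilityMeasure_map (μ := P) hY.aemeasurable
  have hX0' : ∀ᵐ x ∂(P.map X), x ≠ 0 := by
    refine (measure_eq_zero_iff_ae_notMem (s := {0})).mp ?_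
    rw [Measure.map_apply hX (measurableSet_singleton 0)]; exact hX0
  have hY0' : (P.map Y) {0} = 0 := by
    rw [Measure.map_apply hY (measurableSet_singleton 0)]; exact hY0
  have hs : MeasurableSet {z : E × E | t ≤ absCos z.1 z.2} :=
    measurableSet_le measurable_const (measurable_absCos measurable_fst measurable_snd)
  have h := (indepFun_iff_map_prod_eq_prod_map_map hX.aemeasurable hY.aemeasurable).mp hXY
  have h1 : P {ω | t ≤ absCos (X ω) (Y ω)} =
      ((P.map X).prod (P.map Y)) {z : E × E | t ≤ absCos z.1 z.2} := by
    rw [← h, Measure.map_apply (hX.prodMk hY) hs]; rfl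
  rw [measureReal_def, h1, Measure.prod_apply hs,
    lintegral_congr_ae (g := fun _ => ENNReal.ofReal (capProb m t))]
  · have h0 : 0 ≤ capProb m t := by
      have : Nontrivial E := Module.nontrivial_of_finrank_pos (R := ℝ) (by omega)
      obtain ⟨x, hx⟩ := exists_ne (0 : E)
      rw [← hrY.measureReal_le_absCos hm hE hY0' ht ht1 hx]
      positivity
    simp [h0]
  · filter_upwards [hX0'] with x hx
    rw [← hrY.measureReal_le_absCos hm hE hY0' ht ht1 hx, ofReal_measureReal]
    rfl

/-- Given the shared vector `X`, the two events concern the independent `Y` and `Z`, and each has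
the conditional probability `capProb m t` whatever the value of `X ≠ 0`. -/
lemma measureReal_le_absCos_triple (hm : m ≠ 0) (hE : Module.finrank ℝ E = m + 1) (ht : 0 < t)
    (ht1 : t ≤ 1) {X Y Z : Ω → E} (hX : Measurable X) (hY : Measurable Y) (hZ : Measurable Z)
    (hYZX : IndepFun (fun ω => (Y ω, Z ω)) X P) (hYZ : IndepFun Y Z P)
    (hrY : ReflectionInvariant (P.map Y)) (hrZ : ReflectionInvariant (P.map Z))
    (hX0 : P {ω | X ω = 0} = 0) (hY0 : P {ω | Y ω = 0} = 0) (hZ0 : P {ω | Z ω = 0} = 0) :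
    P.real ({ω | t ≤ absCos (X ω) (Y ω)} ∩ {ω | t ≤ absCos (X ω) (Z ω)}) = capProb m t ^ 2 := by
  have := Measure.isProbabilityMeasure_map (μ := P) hX.aemeasurable
  have := Measure.isProbabilityMeasure_map (μ := P) hY.aemeasurable
  have := Measure.isProbabilityMeasure_map (μ := P) hZ.aemeasurable
  have hX0' : ∀ᵐ x ∂(P.map X), x ≠ 0 := by
    refine (measure_eq_zero_iff_ae_notMem (s := {0})).mp ?_
    rw [Measure.map_apply hX (measurableSet_singleton 0)]; exact hX0
  have hY0' : (P.map Y) {0} = 0 := by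
    rw [Measure.map_apply hY (measurableSet_singleton 0)]; exact hY0
  have hZ0' : (P.map Z) {0} = 0 := by
    rw [Measure.map_apply hZ (measurableSet_singleton 0)]; exact hZ0
  have hs : MeasurableSet {z : (E × E) × E | t ≤ absCos z.2 z.1.1 ∧ t ≤ absCos z.2 z.1.2} :=
    (measurableSet_le measurable_const
      (measurable_absCos measurable_snd (measurable_fst.comp measurable_fst))).inter
    (measurableSet_le measurable_const
      (measurable_absCos measurable_snd (measurable_snd.comp measurable_fst)))
  have h := (indepFun_iff_map_prod_eq_prod_map_map (hY.prodMk hZ).aemeasurable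
    hX.aemeasurable).mp hYZX
  rw [(indepFun_iff_map_prod_eq_prod_map_map hY.aemeasurable hZ.aemeasurable).mp hYZ] at h
  have h1 : P ({ω | t ≤ absCos (X ω) (Y ω)} ∩ {ω | t ≤ absCos (X ω) (Z ω)}) =
      (((P.map Y).prod (P.map Z)).prod (P.map X))
        {z : (E × E) × E | t ≤ absCos z.2 z.1.1 ∧ t ≤ absCos z.2 z.1.2} := by
    rw [← h, Measure.map_apply ((hY.prodMk hZ).prodMk hX) hs]; rfl
  rw [measureReal_def, h1, Measure.prod_apply_symm hs,
    lintegral_congr_ae (g := fun _ => ENNReal.ofReal (capProb m t ^ 2))]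
  · have h0 : 0 ≤ capProb m t ^ 2 := sq_nonneg _
    simp [h0]
  · filter_upwards [hX0'] with x hx
    have e : (fun y : E × E => (y, x)) ⁻¹'
        {z : (E × E) × E | t ≤ absCos z.2 z.1.1 ∧ t ≤ absCos z.2 z.1.2} =
        {y | t ≤ absCos x y} ×ˢ {y | t ≤ absCos x y} := rfl
    rw [e, Measure.prod_prod, ← ofReal_measureReal, ← ofReal_measureReal,
      hrY.measureReal_le_absCos hm hE hY0' ht ht1 hx,
      hrZ.measureReal_le_absCos hm hE hZ0' ht ht1 hx, ← ENNReal.ofReal_mul, sq]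
    rw [← hrY.measureReal_le_absCos hm hE hY0' ht ht1 hx]
    positivity

/-- Poisson approximation for the number of pairs of independent spherical vectors that make a
small angle. -/
theorem abs_prob_absCos_lt_sub_exp_le (hm : m ≠ 0) (hE : Module.finrank ℝ E = m + 1) (ht : 0 < t)
    (ht1 : t ≤ 1) {p : ℕ} {Z : Fin p → Ω → E} (hZ : ∀ j, Measurable (Z j))
    (hind : iIndepFun Z P) (hr : ∀ j, ReflectionInvariant (P.map (Z j)))
    (h0 : ∀ j, P {ω | Z j ω = 0} = 0) :
    |P.real {ω | ∀ a : IndexPair p, ¬ t ≤ absCos (Z a.1.1 ω) (Z a.1.2 ω)} -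
      Real.exp (-((p : ℝ) * (p - 1) / 2 * capProb m t))| ≤
      (p : ℝ) * (p - 1) / 2 * (2 * (4 * p) * capProb m t ^ 2) := by
  have key := abs_prob_none_sub_exp_le P
    (fun a : IndexPair p => {ω | t ≤ absCos (Z a.1.1 ω) (Z a.1.2 ω)})
    (fun a => measurableSet_le measurable_const (measurable_absCos (hZ _) (hZ _)))
    IndexPair.neighbors (fun a => by simp [IndexPair.neighbors]) (M := 4 * p) (q := capProb m t)
    (fun a => by exact_mod_cast a.card_neighbors_le) ?_ ?_ ?_
  · rw [card_indexPair] at key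
    exact key
  · intro a
    exact measureReal_le_absCos_pair hm hE ht ht1 (hZ _) (hZ _) (hind.indepFun a.2.ne) (hr _)
      (h0 _) (h0 _)
  · have h3 : ∀ i j k : Fin p, i ≠ j → i ≠ k → j ≠ k →
        P.real ({ω | t ≤ absCos (Z i ω) (Z j ω)} ∩ {ω | t ≤ absCos (Z i ω) (Z k ω)}) =
          capProb m t ^ 2 := fun i j k hij hik hjk =>
      measureReal_le_absCos_triple hm hE ht ht1 (hZ i) (hZ j) (hZ k)
        (hind.indepFun_prodMk hZ j k i hij.symm hik.symm) (hind.indepFun hjk) (hr j) (hr k)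
        (h0 i) (h0 j) (h0 k)
    rintro ⟨⟨i, j⟩, hij⟩ ⟨⟨k, l⟩, hkl⟩ hb hne
    simp only [IndexPair.neighbors, Finset.mem_filter, Finset.mem_univ, true_and] at hb
    simp only at hij hkl
    have hne' : ¬ (k = i ∧ l = j) := by
      rintro ⟨rfl, rfl⟩; exact hne rfl
    rcases hb with rfl | rfl | rfl | rfl
    · exact h3 _ _ _ hij.ne hkl.ne (fun h => hne' ⟨rfl, h.symm⟩)
    · have := h3 k i l hij.ne' hkl.ne (hij.trans hkl).ne
      simpa only [absCos_comm] using this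
    · have := h3 l j k hij.ne hkl.ne' (hkl.trans hij).ne'
      simpa only [absCos_comm] using this
    · have := h3 l i k hij.ne' hkl.ne' (fun h => hne' ⟨h.symm, rfl⟩)
      simpa only [absCos_comm] using this
  · intro a
    set S : Finset (Fin p) := {a.1.1, a.1.2} with hS
    have h1 : a.1.1 ∈ S := by simp [hS]
    have h2 : a.1.2 ∈ S := by simp [hS]
    -- Extension by zero lets the sum over non-neighbours be written as a function of the vectors
    -- outside `S` alone. The default 0 is never used, since both indices of a non-neighbour lie in
    -- `Sᶜ`.
    let e : ((↥Sᶜ) → E) → Fin p → E := fun x k => if h : k ∈ Sᶜ then x ⟨k, h⟩ else 0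
    have he : ∀ k, Measurable fun x => e x k := by
      intro k
      by_cases h : k ∈ Sᶜ
      · simp only [e, h, dite_true]; fun_prop
      · simp only [e, h, dite_false]; fun_prop
    have hcomp := (hind.indepFun_finset S Sᶜ disjoint_compl_right hZ).comp
      (φ := {x : S → E | t ≤ absCos (x ⟨_, h1⟩) (x ⟨_, h2⟩)}.indicator (1 : (S → E) → ℕ))
      (ψ := fun x => ∑ b ∈ a.neighborsᶜ,
        {x | t ≤ absCos (e x b.1.1) (e x b.1.2)}.indicator (1 : (↥Sᶜ → E) → ℕ) x)
      (measurable_one.indicator (measurableSet_le measurable_const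
        (measurable_absCos (measurable_pi_apply (⟨_, h1⟩ : S))
          (measurable_pi_apply (⟨_, h2⟩ : S)))))
      (Finset.measurable_sum _ fun b _ => measurable_one.indicator
        (measurableSet_le measurable_const (measurable_absCos (he _) (he _))))
    convert! hcomp using 1
    ext ω
    refine Finset.sum_congr rfl fun b hb => ?_
    simp only [IndexPair.neighbors, Finset.mem_compl, Finset.mem_filter, Finset.mem_univ, true_and,
      not_or] at hb
    have hb1 : b.1.1 ∈ Sᶜ := by simp [hS, hb]
    have hb2 : b.1.2 ∈ Sᶜ := by simp [hS, hb]
    simp only [Set.indicator_apply, Set.mem_ofPred_eq, e, hb1, hb2, dite_true, Pi.one_apply]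

end SphericalVectors

/-! ### Centering as an orthogonal projection -/

section Centering

/-- The vector `(1, …, 1)`. -/
noncomputable def onesVec (n : ℕ) : EuclideanSpace ℝ (Fin n) := WithLp.toLp 2 fun _ => 1

/-- The hyperplane of the vectors with mean zero. -/
noncomputable abbrev MeanZero (n : ℕ) : Submodule ℝ (EuclideanSpace ℝ (Fin n)) := (ℝ ∙ onesVec n)ᗮ

/-- Centering of a vector, as an orthogonal projection. -/
noncomputable def center {n : ℕ} (x : EuclideanSpace ℝ (Fin n)) : MeanZero n :=
  (MeanZero n).orthogonalProjectionOnto x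

lemma onesVec_ne_zero {n : ℕ} (hn : n ≠ 0) : onesVec n ≠ 0 := by
  intro h
  have := congrArg (fun v => v ⟨0, Nat.pos_of_ne_zero hn⟩) h
  simp [onesVec] at this

lemma finrank_meanZero {n m : ℕ} (hn : n = m + 1) : Module.finrank ℝ (MeanZero n) = m := by
  have : Fact (Module.finrank ℝ (EuclideanSpace ℝ (Fin n)) = m + 1) := ⟨by simpa using hn⟩
  exact Submodule.finrank_orthogonal_span_singleton (onesVec_ne_zero (by omega))

lemma measurable_center {n : ℕ} : Measurable (center (n := n)) :=
  (MeanZero n).orthogonalProjectionOnto.continuous.measurable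

lemma coe_center_apply {n : ℕ} (x : Fin n → ℝ) (k : Fin n) :
    (center (WithLp.toLp 2 x) : EuclideanSpace ℝ (Fin n)) k = x k - coordMean x := by
  have hn : (n : ℝ) ≠ 0 := by
    have := k.pos
    positivity
  have h : (center (WithLp.toLp 2 x) : EuclideanSpace ℝ (Fin n)) =
      WithLp.toLp 2 x - coordMean x • onesVec n := by
    apply Submodule.eq_starProjection_of_mem_of_inner_eq_zero
    · rw [Submodule.mem_orthogonal_singleton_iff_inner_right, inner_sub_right, inner_smul_right]
      simp only [onesVec, PiLp.inner_apply, coordMean]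
      simp
      field_simp
      ring
    · intro w hw
      rw [Submodule.mem_orthogonal_singleton_iff_inner_right] at hw
      rw [sub_sub_cancel, inner_smul_left, hw, mul_zero]
  rw [h]
  simp [onesVec]

lemma abs_pearson {n : ℕ} (x y : Fin n → ℝ) :
    |pearson x y| = absCos (center (WithLp.toLp 2 x)) (center (WithLp.toLp 2 y)) := by
  have hin : ∀ x y : Fin n → ℝ, inner ℝ (center (WithLp.toLp 2 x)) (center (WithLp.toLp 2 y)) =
      ∑ k, (x k - coordMean x) * (y k - coordMean y) := by
    intro x y
    rw [Submodule.coe_inner, PiLp.inner_apply]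
    refine Finset.sum_congr rfl fun k _ => ?_
    rw [coe_center_apply, coe_center_apply]
    simp [mul_comm]
  have hnorm : ∀ x : Fin n → ℝ, ‖center (WithLp.toLp 2 x)‖ = √(∑ k, (x k - coordMean x) ^ 2) := by
    intro x
    rw [norm_eq_sqrt_real_inner, hin]
    simp only [sq]
  rw [pearson, absCos, hin, hnorm, hnorm, abs_div, abs_of_nonneg (Real.sqrt_nonneg _),
    Real.sqrt_mul (by positivity)]

lemma reflection_orthogonal_singleton_apply {E : Type*} [NormedAddCommGroup E]
    [InnerProductSpace ℝ E] (v w : E) :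
    (ℝ ∙ v)ᗮ.reflection w = w - (2 * (inner ℝ v w / ‖v‖ ^ 2)) • v := by
  rw [Submodule.reflection_orthogonal_apply, Submodule.reflection_singleton_apply, mul_smul,
    two_smul, two_smul]
  simp

/-- For `v` of mean zero, centering fixes `v` and does not change the inner product with `v`. Thus
invariance passes to the hyperplane. -/
lemma center_reflection {n : ℕ} (v : MeanZero n) (w : EuclideanSpace ℝ (Fin n)) :
    center ((ℝ ∙ (v : EuclideanSpace ℝ (Fin n)))ᗮ.reflection w) =
      (ℝ ∙ v)ᗮ.reflection (center w) := by
  rw [reflection_orthogonal_singleton_apply, reflection_orthogonal_singleton_apply, center,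
    map_sub, map_smul, Submodule.orthogonalProjectionOnto_mem_subspace_eq_self]
  congr 3
  rw [center, Submodule.inner_orthogonalProjectionOnto_eq_of_mem_left]
  simp

lemma ReflectionInvariant.map_center {n : ℕ} {μ : Measure (EuclideanSpace ℝ (Fin n))}
    (hμ : ReflectionInvariant μ) : ReflectionInvariant (μ.map center) := by
  intro v
  conv_rhs => rw [← hμ v]
  rw [Measure.map_map (by fun_prop) measurable_center,
    Measure.map_map measurable_center (by fun_prop)]
  congr 1
  ext w : 1
  exact (center_reflection v w).symm

lemma IsSpherical.reflectionInvariant {Ω : Type*} [MeasurableSpace Ω] {P : Measure Ω} {n : ℕ}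
    {Y : Ω → Fin n → ℝ} (h : IsSpherical P Y) (hY : Measurable Y) :
    ReflectionInvariant (E := EuclideanSpace ℝ (Fin n)) (P.map fun ω => WithLp.toLp 2 (Y ω)) := by
  intro v
  set R := (ℝ ∙ v)ᗮ.reflection with hR
  set b := EuclideanSpace.basisFun (Fin n) ℝ with hb
  set O : Matrix (Fin n) (Fin n) ℝ := b.toBasis.toMatrix (b.map R) with hO
  have hmem : O ∈ Matrix.orthogonalGroup (Fin n) ℝ :=
    b.toMatrix_orthonormalBasis_mem_unitary (b.map R)
  have hOR : ∀ x : Fin n → ℝ, WithLp.toLp 2 (O.mulVec x) = R (WithLp.toLp 2 x) := by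
    intro x
    have hx : WithLp.toLp 2 x = ∑ j, x j • b j := by
      rw [← b.sum_repr (WithLp.toLp 2 x)]
      simp [hb]
    rw [hx, map_sum]
    ext i
    simp [hO, Module.Basis.toMatrix_apply, Matrix.mulVec, dotProduct, hb, mul_comm]
  have hm : Measurable (WithLp.toLp 2 : (Fin n → ℝ) → EuclideanSpace ℝ (Fin n)) :=
    WithLp.measurable_toLp 2 _
  have hmY : Measurable fun ω => (WithLp.toLp 2 (Y ω) : EuclideanSpace ℝ (Fin n)) := hm.comp hY
  have h1 := ((h O hmem).comp hm).map_eq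
  rw [Measure.map_map R.continuous.measurable hmY]
  convert! h1 using 2
  ext ω : 1
  exact (hOR (Y ω)).symm

/-- The centered vector vanishes exactly on the line of constant vectors. Off the origin this line
is the event that the cosine with `onesVec n` is 1, which has probability `capProb (n - 1) 1 = 0`.
-/
lemma measure_center_eq_zero {Ω : Type*} [MeasurableSpace Ω] {P : Measure Ω}
    [IsProbabilityMeasure P] {n : ℕ} (hn : 2 ≤ n) {Y : Ω → Fin n → ℝ} (h : IsSpherical P Y)
    (hY : Measurable Y) (h0 : P {ω | Y ω = 0} = 0) :
    P {ω | center (WithLp.toLp 2 (Y ω)) = 0} = 0 := by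
  have hm : Measurable fun ω => (WithLp.toLp 2 (Y ω) : EuclideanSpace ℝ (Fin n)) := (WithLp.measurable_toLp 2 _).comp hY
  have := Measure.isProbabilityMeasure_map (μ := P) hm.aemeasurable
  have hr := h.reflectionInvariant hY
  have h0' : P.map (fun ω => WithLp.toLp 2 (Y ω)) {0} = 0 := by
    rw [Measure.map_apply hm (measurableSet_singleton 0)]
    convert h0 using 2
    ext ω
    simp
  have key := hr.measureReal_le_absCos (m := n - 1) (by omega) (by simp; omega) h0' one_pos le_rfl
    (onesVec_ne_zero (n := n) (by omega))
  rw [capProb_one (by omega), measureReal_eq_zero_iff,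
    Measure.map_apply hm (measurableSet_le_absCos _ _)] at key
  refine measure_mono_null ?_ (measure_union_null key h0)
  intro ω hω
  rw [Set.mem_ofPred_eq, center, Submodule.orthogonalProjectionOnto_eq_zero_iff,
    Submodule.orthogonal_orthogonal, Submodule.mem_span_singleton] at hω
  obtain ⟨c, hc⟩ := hω
  by_cases hc0 : c = 0
  · right
    rw [hc0, zero_smul] at hc
    exact ((WithLp.toLp_eq_zero 2).mp hc.symm)
  · left
    change 1 ≤ absCos (onesVec n) (WithLp.toLp 2 (Y ω))
    rw [← hc, absCos_comm, absCos_smul_left hc0, absCos, real_inner_self_eq_norm_sq, ← sq, abs_sq,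
      div_self]
    exact pow_ne_zero 2 (norm_ne_zero_iff.mpr (onesVec_ne_zero (by omega)))

end Centering

/-! ### Coherence as a maximum of cosines -/

section Coherence

variable {n p : ℕ}

lemma coherence_nonneg (x : Fin p → Fin n → ℝ) : 0 ≤ coherence x :=
  Real.iSup_nonneg fun _ => abs_nonneg _

lemma coherence_le_one (x : Fin p → Fin n → ℝ) : coherence x ≤ 1 :=
  Real.iSup_le (fun _ => by rw [abs_pearson]; exact absCos_le_one _ _) zero_le_one

/-- Positivity of `t` covers the case without pairs, where the supremum is 0 by convention. -/
lemma le_coherence_iff {t : ℝ} (ht : 0 < t) (x : Fin p → Fin n → ℝ) :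
    t ≤ coherence x ↔ ∃ a : IndexPair p,
      t ≤ absCos (center (WithLp.toLp 2 (x a.1.1))) (center (WithLp.toLp 2 (x a.1.2))) := by
  simp only [← abs_pearson]
  constructor
  · intro h
    rcases isEmpty_or_nonempty (IndexPair p) with he | he
    · rw [coherence, Real.iSup_of_isEmpty] at h
      linarith
    · obtain ⟨a, ha⟩ := exists_eq_ciSup_of_finite
        (f := fun q : IndexPair p => |pearson (x q.1.1) (x q.1.2)|)
      exact ⟨a, h.trans ha.ge⟩
  · rintro ⟨a, ha⟩
    exact ha.trans (le_ciSup (f := fun q : IndexPair p => |pearson (x q.1.1) (x q.1.2)|)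
      (Set.finite_range _).bddAbove a)

lemma measurable_coherence {Ω : Type*} [MeasurableSpace Ω] {X : Fin p → Ω → Fin n → ℝ}
    (hX : ∀ j, Measurable (X j)) : Measurable fun ω => coherence fun j => X j ω := by
  unfold coherence
  refine Measurable.iSup fun q => ?_
  simp only [abs_pearson]
  exact measurable_absCos (measurable_center.comp ((WithLp.measurable_toLp 2 _).comp (hX _)))
    (measurable_center.comp ((WithLp.measurable_toLp 2 _).comp (hX _)))

variable {Ω : Type*} [MeasurableSpace Ω] {P : Measure Ω}
  {X : Fin p → Ω → Fin n → ℝ}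

lemma measurable_center_toLp {Y : Ω → Fin n → ℝ} (hY : Measurable Y) :
    Measurable fun ω => center (WithLp.toLp 2 (Y ω)) :=
  measurable_center.comp ((WithLp.measurable_toLp 2 _).comp hY)

lemma IIDSphericalColumns.reflectionInvariant_center (h : IIDSphericalColumns P X) (j : Fin p) :
    ReflectionInvariant (P.map fun ω => center (WithLp.toLp 2 (X j ω))) := by
  have hr := ((h.spherical j).reflectionInvariant (h.measurable j)).map_center
  have hm : Measurable fun ω => (WithLp.toLp 2 (X j ω) : EuclideanSpace ℝ (Fin n)) :=
    (WithLp.measurable_toLp 2 _).comp (h.measurable j)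
  rwa [Measure.map_map measurable_center hm] at hr

lemma IIDSphericalColumns.iIndepFun_center (h : IIDSphericalColumns P X) :
    iIndepFun (fun j ω => center (WithLp.toLp 2 (X j ω))) P :=
  h.indep.comp (fun _ x => center (WithLp.toLp 2 x))
    fun _ => measurable_center.comp (WithLp.measurable_toLp 2 _)

/-- Needed because `Real.log 0 = 0` would break the monotonicity of the statistic at coherence 1.
For n = 2 the claim can fail: the centered vectors lie on a line. -/
lemma IIDSphericalColumns.ae_coherence_lt_one [IsProbabilityMeasure P]
    (h : IIDSphericalColumns P X) (hn : 3 ≤ n) :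
    ∀ᵐ ω ∂P, coherence (fun j => X j ω) < 1 := by
  have hz : ∀ j, P {ω | center (WithLp.toLp 2 (X j ω)) = 0} = 0 := fun j =>
    measure_center_eq_zero (by omega) (h.spherical j) (h.measurable j) (h.ne_zero j)
  have key : ∀ a : IndexPair p, ∀ᵐ ω ∂P, ¬ 1 ≤ absCos (center (WithLp.toLp 2 (X a.1.1 ω)))
      (center (WithLp.toLp 2 (X a.1.2 ω))) := by
    intro a
    have := measureReal_le_absCos_pair (m := n - 2) (by omega) (finrank_meanZero (by omega))
      one_pos le_rfl (measurable_center_toLp (h.measurable a.1.1))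
      (measurable_center_toLp (h.measurable a.1.2)) (h.iIndepFun_center.indepFun a.2.ne)
      (h.reflectionInvariant_center a.1.2) (hz _) (hz _)
    rw [capProb_one (by omega), measureReal_eq_zero_iff] at this
    exact measure_eq_zero_iff_ae_notMem.mp this
  filter_upwards [ae_all_iff.mpr key] with ω hω
  by_contra! hc
  obtain ⟨a, ha⟩ := (le_coherence_iff one_pos _).mp hc
  exact hω a ha

lemma IIDSphericalColumns.abs_prob_coherence_lt_sub_exp_le [IsProbabilityMeasure P]
    (h : IIDSphericalColumns P X) (hn : 3 ≤ n) {t : ℝ} (ht : 0 < t) (ht1 : t ≤ 1) :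
    |P.real {ω | coherence (fun j => X j ω) < t} -
      Real.exp (-((p : ℝ) * (p - 1) / 2 * capProb (n - 2) t))| ≤
      (p : ℝ) * (p - 1) / 2 * (2 * (4 * p) * capProb (n - 2) t ^ 2) := by
  have key := abs_prob_absCos_lt_sub_exp_le (P := P) (m := n - 2) (by omega)
    (finrank_meanZero (by omega)) ht ht1 (fun j => measurable_center_toLp (h.measurable j))
    h.iIndepFun_center h.reflectionInvariant_center
    fun j => measure_center_eq_zero (by omega) (h.spherical j) (h.measurable j) (h.ne_zero j)
  convert! key using 5
  ext ω
  rw [← not_le, le_coherence_iff ht, not_exists]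

end Coherence

/-! ### Limit law of the coherence -/

section Limits

variable {Ω : ℕ → Type*} [∀ n, MeasurableSpace (Ω n)] {P : ∀ n, Measure (Ω n)}
  [∀ n, IsProbabilityMeasure (P n)]

/-- Tightness: the limits of `F` at ±∞ give an `M` outside which the mass is eventually below δ, and
`b n` passes `M`. -/
lemma tendsto_prob_le_abs_of_tendsto_cdf {Y : ∀ n, Ω n → ℝ} (hY : ∀ n, AEMeasurable (Y n) (P n))
    {F : ℝ → ℝ} (h : ∀ y, Tendsto (fun n => (P n).real {ω | Y n ω ≤ y}) atTop (𝓝 (F y)))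
    (hF0 : Tendsto F atBot (𝓝 0)) (hF1 : Tendsto F atTop (𝓝 1)) {b : ℕ → ℝ}
    (hb : Tendsto b atTop atTop) :
    Tendsto (fun n => (P n).real {ω | b n ≤ |Y n ω|}) atTop (𝓝 0) := by
  rw [tendsto_order]
  refine ⟨fun a ha => Eventually.of_forall fun n => ha.trans_le measureReal_nonneg,
    fun δ hδ => ?_⟩
  obtain ⟨M, hM0, hM1⟩ := ((hF0.comp tendsto_neg_atTop_atBot).eventually_lt_const
    (half_pos hδ) |>.and (hF1.eventually_const_lt (show 1 - δ / 2 < 1 by linarith))).exists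
  filter_upwards [(h (-M)).eventually_lt_const hM0, (h M).eventually_const_lt hM1,
    hb.eventually_gt_atTop M] with n h0 h1 h2
  have hsub : {ω | b n ≤ |Y n ω|} ⊆ {ω | Y n ω ≤ -M} ∪ {ω | Y n ω ≤ M}ᶜ := by
    intro ω hω
    by_contra! hc
    simp only [Set.mem_union, Set.mem_compl_iff, Set.mem_ofPred_eq, not_or, not_le]
      at hc hω
    have : |Y n ω| ≤ M := abs_le.mpr ⟨hc.1.le, not_lt.mp hc.2⟩
    linarith
  have hm : NullMeasurableSet {ω | Y n ω ≤ M} (P n) :=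
    nullMeasurableSet_le (hY n) aemeasurable_const
  calc (P n).real {ω | b n ≤ |Y n ω|} ≤ _ := measureReal_mono hsub
    _ ≤ _ := measureReal_union_le _ _
    _ = (P n).real {ω | Y n ω ≤ -M} + (1 - (P n).real {ω | Y n ω ≤ M}) := by
      rw [probReal_compl_eq_one_sub₀ hm]
    _ < δ := by linarith

lemma tendstoInProbability_of_eventually_subset {Y : ∀ n, Ω n → ℝ} {c : ℝ}
    (h : ∀ ε : ℝ, 0 < ε → ∃ S : ∀ n, Set (Ω n),
      Tendsto (fun n => (P n).real (S n)) atTop (𝓝 0) ∧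
        ∀ᶠ n in atTop, {ω | ε ≤ |Y n ω - c|} ≤ᵐ[P n] S n) :
    TendstoInProbability P Y c := by
  intro ε hε
  obtain ⟨S, hS, hsub⟩ := h ε hε
  have h1 : Tendsto (fun n => P n (S n)) atTop (𝓝 0) := by
    rw [← ENNReal.tendsto_toReal_iff (fun n => measure_ne_top _ _) ENNReal.zero_ne_top]
    exact hS
  refine tendsto_of_tendsto_of_tendsto_of_le_of_le' tendsto_const_nhds h1
    (Eventually.of_forall fun n => zero_le) ?_
  filter_upwards [hsub] with n hn
  exact measure_mono_ae hn

variable {p : ℕ → ℕ} {X : ∀ n, Fin (p n) → Ω n → Fin n → ℝ}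

lemma tendsto_prob_coherence_lt (hX : ∀ n, 1 ≤ n → IIDSphericalColumns (P n) (X n))
    (hp : Tendsto (fun n : ℕ => Real.log (p n) / n) atTop atTop) (y : ℝ) :
    Tendsto (fun n => (P n).real {ω | coherence (fun j => X n j ω) < corThreshold p y n}) atTop
      (𝓝 (Real.exp (-(1 / √(2 * Real.pi)) * Real.exp (y / 2)))) := by
  set q : ℕ → ℝ := fun n => capProb (n - 2) (corThreshold p y n) with hq
  set κ := 1 / √(2 * Real.pi) * Real.exp (y / 2) with hκ
  have hlim : Tendsto (fun n => (p n : ℝ) ^ 2 / 2 * q n) atTop (𝓝 κ) :=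
    tendsto_sq_mul_capProb hp y
  have hpR : Tendsto (fun n => (p n : ℝ)) atTop atTop :=
    tendsto_natCast_atTop_atTop.comp (tendsto_p hp)
  have hpinv : Tendsto (fun n => ((p n : ℝ))⁻¹) atTop (𝓝 0) := tendsto_inv_atTop_zero.comp hpR
  have hp1 : ∀ᶠ n in atTop, (1 : ℝ) ≤ p n := hpR.eventually_ge_atTop 1
  have hlam : Tendsto (fun n => (p n : ℝ) * (p n - 1) / 2 * q n) atTop (𝓝 κ) := by
    have h := hlim.mul (hpinv.const_sub 1)
    rw [sub_zero, mul_one] at h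
    refine h.congr' ?_
    filter_upwards [hp1] with n hn
    have : (p n : ℝ) ≠ 0 := by linarith
    field_simp
  -- The error equals (p(p-1)q/2) · (p²q/2) · 16/p, with the first two factors convergent.
  have herr : Tendsto (fun n => (p n : ℝ) * (p n - 1) / 2 * (2 * (4 * p n) * q n ^ 2)) atTop
      (𝓝 0) := by
    have h := (hlam.mul hlim).mul (hpinv.const_mul 16)
    rw [mul_zero, mul_zero] at h
    refine h.congr' ?_
    filter_upwards [hp1] with n hn
    have : (p n : ℝ) ≠ 0 := by linarith
    field_simp
    ring
  have hexp : Tendsto (fun n => Real.exp (-((p n : ℝ) * (p n - 1) / 2 * q n))) atTop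
      (𝓝 (Real.exp (-κ))) := (Real.continuous_exp.tendsto _).comp hlam.neg
  rw [neg_mul, ← hκ]
  have hdiff : Tendsto (fun n => (P n).real {ω | coherence (fun j => X n j ω) <
      corThreshold p y n} - Real.exp (-((p n : ℝ) * (p n - 1) / 2 * q n))) atTop (𝓝 0) := by
    refine squeeze_zero_norm' ?_ herr
    filter_upwards [eventually_ge_atTop 3,
      (tendsto_corThreshold hp y).eventually_const_lt zero_lt_one] with n hn ht
    refine (hX n (by omega)).abs_prob_coherence_lt_sub_exp_le hn ht ?_
    rw [corThreshold, Real.sqrt_le_left zero_le_one]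
    linarith [Real.exp_pos (logThreshold p y n)]
  simpa using hdiff.add hexp

/-- The statistic decreases in `L`, so its lower tail is the upper tail of the coherence. -/
lemma statistic_le_iff {n : ℕ} (hn : 3 ≤ n) {y L : ℝ} (hL0 : 0 ≤ L) (hL1 : L < 1) :
    n * Real.log (1 - L ^ 2) + 4 * n / ((n : ℝ) - 2) * Real.log (p n) - Real.log n ≤ y ↔
      corThreshold p y n ≤ L := by
  have hn0 : (0 : ℝ) < n := by positivity
  have hpos : 0 < 1 - L ^ 2 := by nlinarith
  rw [corThreshold, Real.sqrt_le_left hL0, sub_le_comm (a := (1 : ℝ)),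
    ← Real.log_le_iff_le_exp hpos,
    logThreshold, le_div_iff₀ hn0]
  constructor <;> intro h <;> linarith

/-- The distribution function of the normalised statistic converges pointwise. -/
theorem tendsto_prob_statistic_le (hX : ∀ n, 1 ≤ n → IIDSphericalColumns (P n) (X n))
    (hp : Tendsto (fun n : ℕ => Real.log (p n) / n) atTop atTop) (y : ℝ) :
    Tendsto (fun n => (P n).real {ω | n * Real.log (1 - coherence (fun j => X n j ω) ^ 2) +
      4 * n / ((n : ℝ) - 2) * Real.log (p n) - Real.log n ≤ y}) atTop
      (𝓝 (1 - Real.exp (-(1 / √(2 * Real.pi)) * Real.exp (y / 2)))) := by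
  refine ((tendsto_prob_coherence_lt hX hp y).const_sub 1).congr' ?_
  filter_upwards [eventually_ge_atTop 3] with n hn
  have hm := measurable_coherence (hX n (by omega)).measurable
  rw [← probReal_compl_eq_one_sub (measurableSet_lt hm measurable_const)]
  refine measureReal_congr ?_
  filter_upwards [(hX n (by omega)).ae_coherence_lt_one hn] with ω hω
  rw [eq_iff_iff]
  change ¬ coherence (fun j => X n j ω) < _ ↔ _
  rw [not_lt]
  exact (statistic_le_iff hn (coherence_nonneg _) hω).symm

end Limits

/-! ### The theorem -/

theorem mainTheorem3 {Ω : ℕ → Type*} [∀ n, MeasurableSpace (Ω n)]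
    (P : ∀ n, Measure (Ω n)) [∀ n, IsProbabilityMeasure (P n)]
    (p : ℕ → ℕ) (X : ∀ n, Fin (p n) → Ω n → Fin n → ℝ)
    (hX : ∀ n, 1 ≤ n → IIDSphericalColumns (P n) (X n))
    (hp : Tendsto (fun n : ℕ => Real.log (p n) / n) atTop atTop)
    (L T : ∀ n, Ω n → ℝ)
    (hL : ∀ n ω, L n ω = coherence (fun j => X n j ω))
    (hT : ∀ n ω, T n ω = Real.log (1 - L n ω ^ 2)) :
    TendstoInProbability P L 1 ∧
    TendstoInProbability P (fun n ω => n / Real.log (p n) * T n ω) (-4) ∧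
    ConvergesWeaklyToCDF P
      (fun n ω => n * T n ω + 4 * n / ((n : ℝ) - 2) * Real.log (p n) - Real.log n)
      (fun y => 1 - Real.exp (-(1 / √(2 * Real.pi)) * Real.exp (y / 2))) := by
  have hK : 0 < 1 / √(2 * Real.pi) := by positivity
  set Y : ∀ n, Ω n → ℝ :=
    fun n ω => n * T n ω + 4 * n / ((n : ℝ) - 2) * Real.log (p n) - Real.log n with hYdef
  have hYm : ∀ n, AEMeasurable (Y n) (P n) := by
    intro n
    rcases Nat.eq_zero_or_pos n with rfl | hn
    -- No hypothesis on `X` is available at n = 0, but there the factor n makes the statistic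
    -- constant.
    · simp [hYdef]
    · have hm : Measurable (L n) := by
        rw [show L n = fun ω => coherence fun j => X n j ω from funext (hL n)]
        exact measurable_coherence (hX n hn).measurable
      simp only [hYdef, hT]
      exact Measurable.aemeasurable (by fun_prop)
  have hcdf : ∀ y, Tendsto (fun n => (P n).real {ω | Y n ω ≤ y}) atTop
      (𝓝 (1 - Real.exp (-(1 / √(2 * Real.pi)) * Real.exp (y / 2)))) := by
    intro y
    simp only [hYdef, hT, hL]
    exact tendsto_prob_statistic_le hX hp y
  have hlogp := tendsto_log_p hp
  have htail : ∀ {b : ℕ → ℝ}, Tendsto b atTop atTop →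
      Tendsto (fun n => (P n).real {ω | b n ≤ |Y n ω|}) atTop (𝓝 0) :=
    tendsto_prob_le_abs_of_tendsto_cdf hYm hcdf (tendsto_limitCDF_atBot _)
      (tendsto_limitCDF_atTop hK)
  have hlogn : Tendsto (fun n : ℕ => Real.log n / Real.log (p n)) atTop (𝓝 0) := by
    refine squeeze_zero' (Eventually.of_forall fun n => div_nonneg (Real.log_natCast_nonneg _)
      (Real.log_natCast_nonneg _)) ?_ tendsto_log_div_nat
    filter_upwards [hp.eventually_ge_atTop 1, eventually_ge_atTop 1] with n hn hn1
    have hn0 : (0 : ℝ) < n := by exact_mod_cast hn1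
    rw [le_div_iff₀ hn0, one_mul] at hn
    exact div_le_div_of_nonneg_left (Real.log_natCast_nonneg _) hn0 hn
  have hinv : Tendsto (fun n : ℕ => 8 / ((n : ℝ) - 2)) atTop (𝓝 0) :=
    (tendsto_atTop_add_const_right _ (-2 : ℝ) tendsto_natCast_atTop_atTop).const_div_atTop 8
  have hii : TendstoInProbability P (fun n ω => n / Real.log (p n) * T n ω) (-4) := by
    refine tendstoInProbability_of_eventually_subset fun ε hε =>
      ⟨fun n => {ω | ε / 2 * Real.log (p n) ≤ |Y n ω|},
        htail (hlogp.const_mul_atTop (half_pos hε)), ?_⟩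
    filter_upwards [hlogp.eventually_gt_atTop 0, eventually_ge_atTop 3,
      hlogn.eventually_lt_const (show (0 : ℝ) < ε / 4 by positivity),
      hinv.eventually_lt_const (show (0 : ℝ) < ε / 4 by positivity)] with n hl hn h1 h2
    refine Eventually.of_forall fun ω (hω : ε ≤ |_|) => ?_
    change ε / 2 * Real.log (p n) ≤ |Y n ω|
    have hn' : (3 : ℝ) ≤ n := by exact_mod_cast hn
    have hn2 : (n : ℝ) - 2 ≠ 0 := by linarith
    -- Uses 4n/(n-2) = 4 + 8/(n-2). The two deterministic remainders are below ε/4, so the random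
    -- term must account for ε/2.
    have e : n / Real.log (p n) * T n ω - -4 =
        Y n ω / Real.log (p n) + Real.log n / Real.log (p n) - 8 / ((n : ℝ) - 2) := by
      simp only [hYdef]
      field_simp
      ring
    rw [e] at hω
    rw [← le_div_iff₀ hl]
    have h3 : |Y n ω / Real.log (p n)| = |Y n ω| / Real.log (p n) := by
      rw [abs_div, abs_of_pos hl]
    have h4 : 0 ≤ Real.log n / Real.log (p n) := div_nonneg (Real.log_natCast_nonneg _) hl.le
    have h5 : 0 ≤ 8 / ((n : ℝ) - 2) := by
      have : 0 < (n : ℝ) - 2 := by linarith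
      positivity
    rw [← h3]
    rcases le_abs.mp hω with h | h
    · exact le_trans (by linarith) (le_abs_self _)
    · exact le_trans (by linarith) (neg_le_abs _)
  refine ⟨?_, hii, ?_⟩
  · refine tendstoInProbability_of_eventually_subset fun ε hε =>
      ⟨fun n => {ω | 1 ≤ |n / Real.log (p n) * T n ω - -4|}, ?_, ?_⟩
    · have h := hii 1 one_pos
      rw [← ENNReal.tendsto_toReal_iff (fun n => measure_ne_top _ _) ENNReal.zero_ne_top] at h
      exact h
    -- If L ≤ 1 - ε then T ≥ log c, so nT/log p is eventually above -1 and hence at distance at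
    -- least 1 from -4. The minimum keeps 1 - min ε 1 nonnegative, so that squaring preserves the
    -- inequality.
    · set c := 1 - (1 - min ε 1) ^ 2 with hc
      have hm0 : 0 < min ε 1 := lt_min hε one_pos
      have hm1 : min ε 1 ≤ 1 := min_le_right _ _
      have hc0 : 0 < c := by nlinarith
      have hlim : Tendsto (fun n : ℕ => n / Real.log (p n) * Real.log c) atTop (𝓝 0) := by
        have := hp.inv_tendsto_atTop.mul_const (Real.log c)
        simpa using this
      filter_upwards [hlim.eventually_const_lt (show (-1 : ℝ) < 0 by norm_num)] with n hn
      refine Eventually.of_forall fun ω (hω : ε ≤ |_|) => ?_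
      change 1 ≤ |n / Real.log (p n) * T n ω - -4|
      have hL0 : 0 ≤ L n ω := by rw [hL]; exact coherence_nonneg _
      have hL1 : L n ω ≤ 1 := by rw [hL]; exact coherence_le_one _
      rw [abs_of_nonpos (by linarith)] at hω
      have hcl : c ≤ 1 - L n ω ^ 2 := by
        have : L n ω ≤ 1 - min ε 1 := by linarith [min_le_left ε 1]
        nlinarith
      have hTc : Real.log c ≤ T n ω := by
        rw [hT]
        exact Real.log_le_log hc0 hcl
      have h0 : 0 ≤ n / Real.log (p n) := div_nonneg (Nat.cast_nonneg _)
        (Real.log_natCast_nonneg _)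
      have := mul_le_mul_of_nonneg_left hTc h0
      rw [abs_of_nonneg] <;> linarith
  · obtain ⟨ν, hν, hνF⟩ := exists_measure_limitCDF hK
    exact ⟨ν, hν, hνF, tendstoInDistribution_of_tendsto_cdf hYm fun y => by
      rw [hνF]; exact hcdf y⟩
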